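/- **Setting.** Let $N\ge 2$ be an integer, $h=1/N$, and let $0<t<1$ with $t\ne h\beta$ for $\beta=0,1,\dots,N$. Integrals $\int_0^1\frac{\varphi(x)}{x-t}\,dx$ are Cauchy principal values. Let $L_2^{(2)}(0,1)$ be the space of (continuous representatives on $[0,1]$ of) real functions $\varphi$ with a generalized second derivative $\varphi''\in L_2(0,1)$, with the seminorm $\|\varphi\|=\left(\int_0^1|\varphi''(x)|^2dx\right)^{1/2}$. For $C=(C_0,\dots,C_N)\in\mathbb R^{N+1}$ let $$\ell_C(\varphi)=\int_0^1\frac{\varphi(x)}{x-t}\,dx-\sum_{\beta=0}^N C_\beta\,\varphi(h\beta),\qquad \|\ell_C\|=\sup_{\|\varphi\|\le 1}|\ell_C(\varphi)|\in[0,\infty].$$ The quadrature formula $\int_0^1\frac{\varphi(x)}{x-t}dx\cong\sum_{\beta=0}^N C_\beta\varphi(h\beta)$ is *optimal in the sense of Sard* if $\|\ell_C\|<\infty$ and $\|\ell_C\|\le\|\ell_{C'}\|$ for all $C'\in\mathbb R^{N+1}$. **Notation.** Put $q=\sqrt3-2$, $$f(y,t)=\tfrac1{12}\Big(-\tfrac{11}{3}y^3+(5t+3)y^2-\big(2t^2+3t+\tfrac32\big)y+t^2+\tfrac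 t2+\tfrac13+(t-y)^3\big(-2\ln|y-t|+\ln(t-t^2)\big)\Big),$$ $$g_0=\ln\tfrac{1-t}{t},\qquad g_1=1+t\ln\tfrac{1-t}{t},$$ $$A_1=3q+2,\quad A_2=h(2q+1),\quad A_3=h^2q,\quad B_1=3q^N(3q+1),\quad B_2=hq^N(2q+1),\quad B_3=-h^2q^{N+1},$$ $$F_1=6(q+2)\sum_{\gamma=1}^Nq^{\gamma+1}f(h\gamma,t)-(12q+5)f(0,t),\qquad F_2=6(q+2)\sum_{\gamma=0}^{N-1}q^{N+1-\gamma}f(h\gamma,t)-(12q+5)f(1,t),$$ $$R_1=-F_1-\tfrac{g_0}{12}(B_1+3B_2+3B_3)+\tfrac{g_1}{4}(B_1+2B_2+B_3-A_3)-A_1f(0,t)-B_1\big(f(1,t)-\tfrac{g_0}{12}+\tfrac{g_1}{4}\big),$$ $$R_2=-F_2-\tfrac{g_0}{12}(A_1+3A_2+3A_3)+\tfrac{g_1}{4}(A_1+2A_2+A_3-B_3)-B_1f(0,t)-A_1\big(f(1,t)-\tfrac{g_0}{12}+\tfrac{g_1}{4}\big),$$ $$\Delta=B_2^2-A_2^2,\qquad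 \Delta_1=A_2R_1-B_2R_2,\qquad \Delta_2=-A_2R_2+B_2R_1,$$ $$a_1^-=\frac{\Delta_1}{\Delta},\qquad a_1^+=\frac{\Delta_2}{\Delta},\qquad a_0^-=f(0,t),\qquad a_0^+=f(1,t)-\tfrac1{12}g_0+\tfrac14g_1-\frac{\Delta_2}{\Delta}.$$ **Theorem 1.** The principal value $\int_0^1\frac{\varphi(x)}{x-t}dx$ exists for every $\varphi\in L_2^{(2)}(0,1)$; moreover $f(h\beta,t)=\frac1{12}\int_0^1\frac{|x-h\beta|^3}{x-t}dx$ for $\beta=0,\dots,N$, $g_0=\int_0^1\frac{dx}{x-t}$, $g_1=\int_0^1\frac{x\,dx}{x-t}$, and $\Delta\ne0$. (i) There is exactly one Sard-optimal formula, and its coefficients $C_\beta=C([\beta],t)$ are $$\begin{aligned}C([0],t)=\frac6{h^3}\Big[&\tfrac{g_0}{12}\big(h^3-3q^N(h^2+h(q+2))\big)+\tfrac{g_1q^N}{4}\big(h^2+2h(q+2)\big)+a_1^-h(q+1)+f(0,t)(3q+2)\\&-f(h,t)(12q+5)-q^N\big(3f(1,t)(q+1)+a_1^+h(q+2)\big)+6(q+2)\sum_{\gamma=2}^Nq^\gamma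 f(h\gamma,t)\Big],\end{aligned}$$ for $1\le\beta\le N-1$: $$\begin{aligned}C([\beta],t)=\frac6{h^3}\Big[&6(q+2)\sum_{\gamma=0}^{\beta-2}q^{\beta-\gamma}f(h\gamma,t)-(12q+5)\big(f(h(\beta-1),t)+f(h(\beta+1),t)\big)+(6q+4)f(h\beta,t)\\&+6(q+2)\sum_{\gamma=\beta+2}^Nq^{\gamma-\beta}f(h\gamma,t)+\tfrac{g_1}{4}\big(q^{N-\beta}(2h(q+2)+h^2)-q^\beta h^2\big)\\&+q^\beta\big(a_1^-h(q+2)-3f(0,t)(q+1)\big)-q^{N-\beta}\big(3f(1,t)(q+1)+\tfrac{g_0}{4}(h(q+2)+h^2)+a_1^+h(q+2)\big)\Big],\end{aligned}$$ $$\begin{aligned}C([N],t)=\frac6{h^3}\Big[&-\tfrac{g_0}{12}\big(3h(q+1)-h^3\big)+\tfrac{g_1}{4}\big(2h(q+1)-q^Nh^2\big)+q^N\big(a_1^-h(q+2)-3f(0,t)(q+1)\big)-a_1^+h(q+1)\\&+f(1,t)(3q+2)-f(1-h,t)(12q+5)+6(q+2)\sum_{\gamma=0}^{N-2}q^{N-\gamma}f(h\gamma,t)\Big]\end{aligned}$$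 (empty sums are $0$). (ii) The linear system in the unknowns $C_0,\dots,C_N,p_1,p_0$ $$\sum_{\gamma=0}^NC_\gamma\frac{|h\beta-h\gamma|^3}{12}+p_1h\beta+p_0=f(h\beta,t)\quad(\beta=0,\dots,N),\qquad\sum_{\gamma=0}^NC_\gamma=g_0,\qquad\sum_{\gamma=0}^NC_\gamma h\gamma=g_1$$ has exactly one solution, namely $C_\beta=C([\beta],t)$ from (i) with $p_1=\frac12(a_1^-+a_1^+)$ and $p_0=\frac12(a_0^-+a_0^+)$. For this solution the function $u(y)=\sum_{\gamma=0}^NC_\gamma\frac{|y-h\gamma|^3}{12}+p_1y+p_0$ satisfies, for all integers $k$, $$u(hk)=-\tfrac1{12}(hk)^3g_0+\tfrac14(hk)^2g_1+a_1^-\,hk+a_0^-\quad(k\le0),\qquad u(hk)=\tfrac1{12}(hk)^3g_0-\tfrac14(hk)^2g_1+a_1^+\,hk+a_0^+\quad(k\ge N).$$ -/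

import Mathlib

open Set Filter Topology MeasureTheory
open scoped ENNReal ContDiff

namespace CauchyQuad

noncomputable section

/-! ### The singular integral and the Sobolev space -/

/-- The integral of `φ x / (x - t)` over `(0,1)` without the interval `(t - ε, t + ε)`. -/
def truncatedIntegral (φ : ℝ → ℝ) (t ε : ℝ) : ℝ :=
  (∫ x in (0 : ℝ)..(t - ε), φ x / (x - t)) + ∫ x in (t + ε)..(1 : ℝ), φ x / (x - t)

/-- The Cauchy type singular integral of `φ x / (x - t)` over `(0,1)` exists, as a principal value,
and equals `I`. -/
def HasSingularIntegral (φ : ℝ → ℝ) (t I : ℝ) : Prop :=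
  Tendsto (truncatedIntegral φ t) (𝓝[>] (0 : ℝ)) (𝓝 I)

/-- The value of the Cauchy type singular integral (a principal value). -/
def singularIntegral (φ : ℝ → ℝ) (t : ℝ) : ℝ :=
  limUnder (𝓝[>] (0 : ℝ)) (truncatedIntegral φ t)

/-- `g` is the generalized second derivative of `φ` on the interval `(0,1)`. -/
def IsWeakSecondDeriv (φ g : ℝ → ℝ) : Prop :=
  ∀ ψ : ℝ → ℝ, ContDiff ℝ ∞ ψ → HasCompactSupport ψ → tsupport ψ ⊆ Ioo (0 : ℝ) 1 →
    ∫ x in Ioo (0 : ℝ) 1, φ x * iteratedDeriv 2 ψ x = ∫ x in Ioo (0 : ℝ) 1, g x * ψ x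

/-- `φ` belongs to the Sobolev space of functions on `(0,1)` with a square integrable generalized
second derivative `g`; as point values are used, `φ` is the continuous representative on `[0,1]`. -/
structure MemSobolevWith (φ g : ℝ → ℝ) : Prop where
  continuousOn : ContinuousOn φ (Icc (0 : ℝ) 1)
  memLp : MemLp g 2 (volume.restrict (Ioo (0 : ℝ) 1))
  weakDeriv : IsWeakSecondDeriv φ g

/-! ### Quadrature formulas with equally spaced nodes and their optimality -/

/-- The step `h = 1 / N`. -/
def step (N : ℕ) : ℝ := 1 / (N : ℝ)

/-- The error functional of the quadrature formula with coefficients `C` and nodes `hβ`. -/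
def quadError (N : ℕ) (t : ℝ) (C : Fin (N + 1) → ℝ) (φ : ℝ → ℝ) : ℝ :=
  singularIntegral φ t - ∑ β : Fin (N + 1), C β * φ (step N * (β : ℕ))

/-- The norm of the error functional on the Sobolev space with the (semi)norm
`‖φ‖ = (∫₀¹ |φ''|²)^(1/2)`; it is `∞` if the functional is not bounded. -/
def errorNorm (N : ℕ) (t : ℝ) (C : Fin (N + 1) → ℝ) : ℝ≥0∞ :=
  ⨆ (φ : ℝ → ℝ) (g : ℝ → ℝ) (_ : MemSobolevWith φ g)
    (_ : eLpNorm g 2 (volume.restrict (Ioo (0 : ℝ) 1)) ≤ 1), ENNReal.ofReal |quadError N t C φ|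

/-- Optimality in the sense of Sard: for the given nodes, `C` minimizes the (finite) norm of the
error functional among all coefficient vectors. -/
def IsSardOptimal (N : ℕ) (t : ℝ) (C : Fin (N + 1) → ℝ) : Prop :=
  errorNorm N t C < ⊤ ∧ ∀ C' : Fin (N + 1) → ℝ, errorNorm N t C ≤ errorNorm N t C'

/-! ### The right-hand sides and the linear system -/

/-- The function `f(y,t)`, in closed form. -/
def f (y t : ℝ) : ℝ :=
  (1 / 12) * (-(11 / 3) * y ^ 3 + (5 * t + 3) * y ^ 2 - (2 * t ^ 2 + 3 * t + 3 / 2) * y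
    + (t ^ 2 + t / 2 + 1 / 3)
    + (t - y) ^ 3 * (-2 * Real.log |y - t| + Real.log (t - t ^ 2)))

def g₀ (t : ℝ) : ℝ := Real.log ((1 - t) / t)

def g₁ (t : ℝ) : ℝ := 1 + t * Real.log ((1 - t) / t)

/-- The function `u(y) = ∑ γ, C γ * |y - hγ| ^ 3 / 12 + p₁ * y + p₀`. -/
def u (N : ℕ) (C : Fin (N + 1) → ℝ) (p₁ p₀ y : ℝ) : ℝ :=
  (∑ γ : Fin (N + 1), C γ * (|y - step N * (γ : ℕ)| ^ 3 / 12)) + p₁ * y + p₀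

/-- The linear system for the coefficients `C` and the numbers `p₁`, `p₀`. -/
structure SolvesSystem (N : ℕ) (t : ℝ) (C : Fin (N + 1) → ℝ) (p₁ p₀ : ℝ) : Prop where
  eq_f : ∀ β : Fin (N + 1), u N C p₁ p₀ (step N * (β : ℕ)) = f (step N * (β : ℕ)) t
  eq_g₀ : ∑ γ : Fin (N + 1), C γ = g₀ t
  eq_g₁ : ∑ γ : Fin (N + 1), C γ * (step N * (γ : ℕ)) = g₁ t

/-! ### The explicit formulas -/

def q : ℝ := √3 - 2

def A₁ : ℝ := 3 * q + 2

def A₂ (N : ℕ) : ℝ := step N * (2 * q + 1)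

def A₃ (N : ℕ) : ℝ := step N ^ 2 * q

def B₁ (N : ℕ) : ℝ := 3 * q ^ N * (3 * q + 1)

def B₂ (N : ℕ) : ℝ := step N * q ^ N * (2 * q + 1)

def B₃ (N : ℕ) : ℝ := -(step N ^ 2 * q ^ (N + 1))

def F₁ (N : ℕ) (t : ℝ) : ℝ :=
  6 * (q + 2) * (∑ γ ∈ Finset.Icc 1 N, q ^ (γ + 1) * f (step N * γ) t) - (12 * q + 5) * f 0 t

def F₂ (N : ℕ) (t : ℝ) : ℝ :=
  6 * (q + 2) * (∑ γ ∈ Finset.Icc 0 (N - 1), q ^ (N + 1 - γ) * f (step N * γ) t)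
    - (12 * q + 5) * f 1 t

/-- The first bracket occurring in `Δ₁` and `Δ₂`. -/
def R₁ (N : ℕ) (t : ℝ) : ℝ :=
  -F₁ N t - (1 / 12) * g₀ t * (B₁ N + 3 * B₂ N + 3 * B₃ N)
    + (1 / 4) * g₁ t * (B₁ N + 2 * B₂ N + B₃ N - A₃ N)
    - A₁ * f 0 t - B₁ N * (f 1 t - (1 / 12) * g₀ t + (1 / 4) * g₁ t)

/-- The second bracket occurring in `Δ₁` and `Δ₂`. -/
def R₂ (N : ℕ) (t : ℝ) : ℝ :=
  -F₂ N t - (1 / 12) * g₀ t * (A₁ + 3 * A₂ N + 3 * A₃ N)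
    + (1 / 4) * g₁ t * (A₁ + 2 * A₂ N + A₃ N - B₃ N)
    - B₁ N * f 0 t - A₁ * (f 1 t - (1 / 12) * g₀ t + (1 / 4) * g₁ t)

def Δ (N : ℕ) : ℝ := B₂ N ^ 2 - A₂ N ^ 2

def Δ₁ (N : ℕ) (t : ℝ) : ℝ := A₂ N * R₁ N t - B₂ N * R₂ N t

def Δ₂ (N : ℕ) (t : ℝ) : ℝ := -(A₂ N * R₂ N t) + B₂ N * R₁ N t

def a₁neg (N : ℕ) (t : ℝ) : ℝ := Δ₁ N t / Δ N

def a₁pos (N : ℕ) (t : ℝ) : ℝ := Δ₂ N t / Δ N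

def a₀neg (t : ℝ) : ℝ := f 0 t

def a₀pos (N : ℕ) (t : ℝ) : ℝ :=
  f 1 t - (1 / 12) * g₀ t + (1 / 4) * g₁ t - Δ₂ N t / Δ N

/-- The coefficient at the node `0`. -/
def coeffFirst (N : ℕ) (t : ℝ) : ℝ :=
  let h := step N
  6 / h ^ 3 *
    (g₀ t / 12 * (h ^ 3 - 3 * q ^ N * (h ^ 2 + h * (q + 2)))
      + g₁ t * q ^ N / 4 * (h ^ 2 + 2 * h * (q + 2))
      + a₁neg N t * h * (q + 1) + f 0 t * (3 * q + 2) - f h t * (12 * q + 5)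
      - q ^ N * (3 * f 1 t * (q + 1) + a₁pos N t * h * (q + 2))
      + 6 * (q + 2) * (∑ γ ∈ Finset.Icc 2 N, q ^ γ * f (h * γ) t))

/-- The coefficient at the node `hβ`, for `1 ≤ β ≤ N - 1`; the first sum is over
`0 ≤ γ ≤ β - 2` (empty for `β = 1`). -/
def coeffMiddle (N : ℕ) (t : ℝ) (β : ℕ) : ℝ :=
  let h := step N
  6 / h ^ 3 *
    (6 * (q + 2) * (∑ γ ∈ Finset.range (β - 1), q ^ (β - γ) * f (h * γ) t)
      - (12 * q + 5) * (f (h * ((β : ℝ) - 1)) t + f (h * ((β : ℝ) + 1)) t)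
      + (6 * q + 4) * f (h * β) t
      + 6 * (q + 2) * (∑ γ ∈ Finset.Icc (β + 2) N, q ^ (γ - β) * f (h * γ) t)
      + g₁ t / 4 * (q ^ (N - β) * (2 * h * (q + 2) + h ^ 2) - q ^ β * h ^ 2)
      + q ^ β * (a₁neg N t * h * (q + 2) - 3 * f 0 t * (q + 1))
      - q ^ (N - β) * (3 * f 1 t * (q + 1) + g₀ t / 4 * (h * (q + 2) + h ^ 2)
          + a₁pos N t * h * (q + 2)))

/-- The coefficient at the node `1`; the sum is over `0 ≤ γ ≤ N - 2`. -/
def coeffLast (N : ℕ) (t : ℝ) : ℝ :=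
  let h := step N
  6 / h ^ 3 *
    (-(g₀ t / 12 * (3 * h * (q + 1) - h ^ 3))
      + g₁ t / 4 * (2 * h * (q + 1) - q ^ N * h ^ 2)
      + q ^ N * (a₁neg N t * h * (q + 2) - 3 * f 0 t * (q + 1))
      - a₁pos N t * h * (q + 1) + f 1 t * (3 * q + 2) - f (1 - h) t * (12 * q + 5)
      + 6 * (q + 2) * (∑ γ ∈ Finset.range (N - 1), q ^ (N - γ) * f (h * γ) t))

/-- The vector of the explicit coefficients. -/
def coeff (N : ℕ) (t : ℝ) (β : Fin (N + 1)) : ℝ :=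
  if (β : ℕ) = 0 then coeffFirst N t
  else if (β : ℕ) = N then coeffLast N t
  else coeffMiddle N t β

end

end CauchyQuad

namespace CauchyQuad

/-! Optimality. On `[0,1]` every function of the space is `a + b x + ∫ max (x - s) 0 * g s ds`,
where `g` is its weak second derivative. The error functional therefore equals `a` and `b` times the
two moment defects of `C`, plus the `L²` pairing of `g` with a bounded Peano kernel `errorKernel`.
Since the seminorm ignores `a` and `b`, the norm is finite only if the formula is exact on `1` and
`x`, and then it is the `L²` norm of the kernel (`exactness_of_errorNorm_lt_top`, `errorNorm_eq`).

The kernels of two exact formulas differ by a piecewise linear function `ramps`, which is the second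
derivative of a combination of the cubics `|x - hβ|^3` whose weights `d` have vanishing moments of
order 0 and 1. If `C` solves the linear system, its error on `|x - hβ|^3` is an affine function of
`hβ`, which such weights annihilate. So the kernel of `C` is orthogonal to every admissible
difference, and Pythagoras (`integral_errorKernel_sq`) makes `C` the unique minimizer. Uniqueness
for the linear system follows from uniqueness of the minimizer.

Existence. It remains to see that the explicit coefficients solve the system. Continue the data `f
(hβ)` to all of `hℤ` by two cubics (`gridValue`). The central fourth difference turns `u` on the
grid into `h^3 / 6` times the (1, 4, 1) convolution of its coefficients. This stencil is inverted by
geometric sums in `q`, a root of `q^2 + 4 q + 1`; the constants `a₁neg`, `a₁pos` solve a 2×2 system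
that makes the equation hold at the two ends as well (`fourthDiff_gridValue`). Hence `gridValue - u`
is one cubic `L` on the whole grid. The averaged choice of `p₁` and `p₀` forces it to be `-L` to the
right of 1, so `L = 0`. This gives the values of `u` and both moment equations together
(`coeff_moments_and_u_eq`). -/

/-! ### Principal values through the difference quotient -/

theorem integral_sub_inv_left {t ε : ℝ} (hε : 0 < ε) (hεt : ε < t) :
    ∫ x in (0 : ℝ)..(t - ε), (x - t)⁻¹ = Real.log (ε / t) := by
  rw [intervalIntegral.integral_comp_sub_right (fun x => x⁻¹) t, integral_inv_of_neg]
  · congr 1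
    rw [show t - ε - t = -ε by ring, show (0 : ℝ) - t = -t by ring, neg_div_neg_eq]
  · linarith
  · linarith

theorem integral_sub_inv_right {t ε : ℝ} (hε : 0 < ε) (hεt : ε < 1 - t) :
    ∫ x in (t + ε)..(1 : ℝ), (x - t)⁻¹ = Real.log ((1 - t) / ε) := by
  rw [intervalIntegral.integral_comp_sub_right (fun x => x⁻¹) t, integral_inv_of_pos]
  · congr 2
    ring
  · linarith
  · linarith

theorem intervalIntegrable_sub_inv {a b t : ℝ} (h : t ∉ uIcc a b) :
    IntervalIntegrable (fun x => (x - t)⁻¹) volume a b := by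
  apply ContinuousOn.intervalIntegrable
  apply ContinuousOn.inv₀ (by fun_prop)
  intro x hx h0
  exact h (by rwa [sub_eq_zero.1 h0] at hx)

/-- Split `φ x / (x - t)` into the difference quotient and `φ t / (x - t)`. The truncated integral
of the first part converges by continuity of its primitive. That of `1 / (x - t)` is `log (ε / t) +
log ((1 - t) / ε)`, in which `ε` cancels, so it equals `g₀ t` for every small `ε`. -/
theorem hasSingularIntegral_of_intervalIntegrable {φ : ℝ → ℝ} {t : ℝ} (ht₀ : 0 < t) (ht₁ : t < 1)
    (hφ : IntervalIntegrable (fun x => (φ x - φ t) / (x - t)) volume 0 1) :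
    HasSingularIntegral φ t ((∫ x in (0 : ℝ)..1, (φ x - φ t) / (x - t)) + φ t * g₀ t) := by
  set ρ : ℝ → ℝ := fun x => (φ x - φ t) / (x - t) with hρ
  have hsplit : ∀ a b : ℝ, a ∈ Icc (0 : ℝ) 1 → b ∈ Icc (0 : ℝ) 1 → IntervalIntegrable ρ volume a b :=
    fun a b ha hb => hφ.mono_set (by
      rw [uIcc_of_le (zero_le_one' ℝ)]
      exact uIcc_subset_Icc ha hb)
  have hprim : ContinuousOn (fun y => ∫ x in (0 : ℝ)..y, ρ x) (Icc 0 1) := by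
    have := intervalIntegral.continuousOn_primitive_interval (f := ρ) (a := 0) (b := 1) (μ := volume)
    rw [uIcc_of_le (zero_le_one' ℝ)] at this
    exact this ((intervalIntegrable_iff_integrableOn_Icc_of_le zero_le_one).1 hφ)
  have hct : ContinuousAt (fun y => ∫ x in (0 : ℝ)..y, ρ x) t :=
    hprim.continuousAt (Icc_mem_nhds ht₀ ht₁)
  have hlim : Tendsto (fun ε : ℝ => ((∫ x in (0 : ℝ)..(t - ε), ρ x) +
      ((∫ x in (0 : ℝ)..1, ρ x) - ∫ x in (0 : ℝ)..(t + ε), ρ x)) + φ t * g₀ t) (𝓝[>] (0 : ℝ))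
      (𝓝 ((∫ x in (0 : ℝ)..1, ρ x) + φ t * g₀ t)) := by
    have h1 : Tendsto (fun ε : ℝ => t - ε) (𝓝[>] (0 : ℝ)) (𝓝 t) := by
      have : Tendsto (fun ε : ℝ => t - ε) (𝓝 (0 : ℝ)) (𝓝 (t - 0)) :=
        (continuous_const.sub continuous_id).tendsto 0
      rw [sub_zero] at this
      exact this.mono_left nhdsWithin_le_nhds
    have h2 : Tendsto (fun ε : ℝ => t + ε) (𝓝[>] (0 : ℝ)) (𝓝 t) := by
      have : Tendsto (fun ε : ℝ => t + ε) (𝓝 (0 : ℝ)) (𝓝 (t + 0)) :=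
        (continuous_const.add continuous_id).tendsto 0
      rw [add_zero] at this
      exact this.mono_left nhdsWithin_le_nhds
    have := ((hct.tendsto.comp h1).add
      ((tendsto_const_nhds (x := ∫ x in (0 : ℝ)..1, ρ x)).sub (hct.tendsto.comp h2))).add
      (tendsto_const_nhds (x := φ t * g₀ t))
    simpa using this
  refine hlim.congr' ?_
  have hsmall : ∀ᶠ ε in 𝓝[>] (0 : ℝ), ε ∈ Ioo 0 (min t (1 - t)) :=
    Ioo_mem_nhdsGT (lt_min ht₀ (by linarith))
  filter_upwards [hsmall] with ε hε
  have hε0 := hε.1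
  have hεt : ε < t := hε.2.trans_le (min_le_left _ _)
  have hεt' : ε < 1 - t := hε.2.trans_le (min_le_right _ _)
  have hdec : ∀ a b : ℝ, a ∈ Icc (0 : ℝ) 1 → b ∈ Icc (0 : ℝ) 1 → t ∉ uIcc a b →
      ∫ x in a..b, φ x / (x - t) = (∫ x in a..b, ρ x) + φ t * ∫ x in a..b, (x - t)⁻¹ := by
    intro a b ha hb h
    rw [← intervalIntegral.integral_const_mul, ← intervalIntegral.integral_add (hsplit a b ha hb)
      ((intervalIntegrable_sub_inv h).const_mul _)]
    refine intervalIntegral.integral_congr fun x _ => ?_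
    simp only [hρ]
    ring
  unfold truncatedIntegral
  rw [hdec 0 (t - ε) ⟨le_rfl, zero_le_one⟩ ⟨by linarith, by linarith⟩
      (by rw [uIcc_of_le (by linarith)]; rintro ⟨-, h⟩; linarith),
    hdec (t + ε) 1 ⟨by linarith, by linarith⟩ ⟨zero_le_one, le_rfl⟩
      (by rw [uIcc_of_le (by linarith)]; rintro ⟨h, -⟩; linarith),
    integral_sub_inv_left hε0 hεt, integral_sub_inv_right hε0 hεt',
    ← intervalIntegral.integral_add_adjacent_intervals
      (hsplit 0 (t + ε) ⟨le_rfl, zero_le_one⟩ ⟨by linarith, by linarith⟩)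
      (hsplit (t + ε) 1 ⟨by linarith, by linarith⟩ ⟨zero_le_one, le_rfl⟩)]
  have hg : g₀ t = Real.log (ε / t) + Real.log ((1 - t) / ε) := by
    have : (1 - t) / t = (ε / t) * ((1 - t) / ε) := by field_simp
    rw [g₀, this, Real.log_mul (by positivity) (div_pos (by linarith) hε0).ne']
  rw [hg]
  ring

theorem HasSingularIntegral.congr {φ χ : ℝ → ℝ} {t I : ℝ} (ht₀ : 0 < t) (ht₁ : t < 1)
    (h : HasSingularIntegral φ t I) (heq : EqOn φ χ (Icc 0 1)) : HasSingularIntegral χ t I := by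
  refine Tendsto.congr' ?_ h
  have hsmall : ∀ᶠ ε in 𝓝[>] (0 : ℝ), ε ∈ Ioo 0 (min t (1 - t)) :=
    Ioo_mem_nhdsGT (lt_min ht₀ (by linarith))
  filter_upwards [hsmall] with ε hε
  have hε0 := hε.1
  have hεt : ε < t := hε.2.trans_le (min_le_left _ _)
  have hεt' : ε < 1 - t := hε.2.trans_le (min_le_right _ _)
  unfold truncatedIntegral
  congr 1
  · refine intervalIntegral.integral_congr fun x hx => ?_
    rw [uIcc_of_le (by linarith)] at hx
    simp only [heq ⟨hx.1, by linarith [hx.2]⟩]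
  · refine intervalIntegral.integral_congr fun x hx => ?_
    rw [uIcc_of_le (by linarith)] at hx
    simp only [heq ⟨by linarith [hx.1], hx.2⟩]

theorem HasSingularIntegral.singularIntegral_eq {φ : ℝ → ℝ} {t I : ℝ}
    (h : HasSingularIntegral φ t I) : singularIntegral φ t = I :=
  h.limUnder_eq

theorem hasSingularIntegral_one {t : ℝ} (ht₀ : 0 < t) (ht₁ : t < 1) :
    HasSingularIntegral (fun _ => 1) t (g₀ t) := by
  simpa using hasSingularIntegral_of_intervalIntegrable (φ := fun _ => 1) ht₀ ht₁ (by simp)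

/-! ### The kernel representation -/

/-- The double primitive of `g` on `(0,1)` that vanishes to first order at `0`. -/
noncomputable def doublePrimitive (g : ℝ → ℝ) (x : ℝ) : ℝ :=
  ∫ s in Ioo (0 : ℝ) 1, max (x - s) 0 * g s

/-- The singular integral of `x ↦ max (x - s) 0`, as a function of `s`. -/
noncomputable def singularKernel (t s : ℝ) : ℝ :=
  (∫ x in Ioo (0 : ℝ) 1, (max (x - s) 0 - max (t - s) 0) / (x - t)) + max (t - s) 0 * g₀ t

/-- The ramp is 1-Lipschitz. Uniformity of the bound in `s` is what later permits Fubini for a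
merely integrable `g`. -/
theorem abs_ramp_quotient_le (x s t : ℝ) : |(max (x - s) 0 - max (t - s) 0) / (x - t)| ≤ 1 := by
  rw [abs_div]
  refine div_le_one_of_le₀ ?_ (abs_nonneg _)
  refine (abs_max_sub_max_le_abs _ _ _).trans (le_of_eq ?_)
  congr 1
  ring

theorem measurable_ramp_quotient (t : ℝ) :
    Measurable (fun p : ℝ × ℝ => (max (p.1 - p.2) 0 - max (t - p.2) 0) / (p.1 - t)) := by
  fun_prop

theorem ramp_nonneg_le {x s : ℝ} (hx : x ≤ 1) (hs : 0 ≤ s) : |max (x - s) 0| ≤ 1 := by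
  rw [abs_of_nonneg (le_max_right _ _)]
  exact max_le (by linarith) zero_le_one

theorem abs_singularKernel_le {t s : ℝ} (ht₁ : t < 1) (hs : 0 ≤ s) :
    |singularKernel t s| ≤ 1 + |g₀ t| := by
  refine (abs_add_le _ _).trans (add_le_add ?_ ?_)
  · have := norm_setIntegral_le_of_norm_le_const (μ := volume) (s := Ioo (0 : ℝ) 1) (C := 1)
      (f := fun x => (max (x - s) 0 - max (t - s) 0) / (x - t)) (by simp)
      (fun x _ => abs_ramp_quotient_le x s t)
    simpa using this
  · rw [abs_mul]
    exact mul_le_of_le_one_left (abs_nonneg _) (ramp_nonneg_le ht₁.le hs)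

theorem stronglyMeasurable_singularKernel (t : ℝ) : StronglyMeasurable (singularKernel t) := by
  refine StronglyMeasurable.add ?_ ?_
  · have : StronglyMeasurable
        (Function.uncurry fun s x : ℝ => (max (x - s) 0 - max (t - s) 0) / (x - t)) := by
      apply Measurable.stronglyMeasurable
      unfold Function.uncurry
      fun_prop
    exact this.integral_prod_right
  · apply Measurable.stronglyMeasurable
    fun_prop

theorem integrable_ramp_mul {g : ℝ → ℝ} (hg : IntegrableOn g (Ioo 0 1)) {x : ℝ} (hx : x ≤ 1) :
    IntegrableOn (fun s => max (x - s) 0 * g s) (Ioo 0 1) := by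
  refine Integrable.bdd_mul (c := 1) hg ?_ ?_
  · apply Continuous.aestronglyMeasurable
    fun_prop
  · filter_upwards [ae_restrict_mem measurableSet_Ioo] with s hs
    exact ramp_nonneg_le hx hs.1.le

/-- For `x ≠ t` the difference quotient is `b` plus the integral over `s` of the ramp quotient times
`g s`. This integrand is integrable on the square, so the quotient is integrable in `x`, and
exchanging the integrals produces `singularKernel`. -/
theorem hasSingularIntegral_doublePrimitive {g : ℝ → ℝ} {t : ℝ} (ht₀ : 0 < t) (ht₁ : t < 1)
    (hg : IntegrableOn g (Ioo 0 1)) (a b : ℝ) :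
    HasSingularIntegral (fun x => a + b * x + doublePrimitive g x) t
      (a * g₀ t + b * g₁ t + ∫ s in Ioo (0 : ℝ) 1, singularKernel t s * g s) := by
  set ρ : ℝ × ℝ → ℝ := fun p => (max (p.1 - p.2) 0 - max (t - p.2) 0) / (p.1 - t) * g p.2 with hρ
  have hint : Integrable ρ ((volume.restrict (Ioo (0 : ℝ) 1)).prod
      (volume.restrict (Ioo (0 : ℝ) 1))) := by
    refine Integrable.bdd_mul (c := 1) (hg.comp_snd _)
      (measurable_ramp_quotient t).aestronglyMeasurable ?_
    exact Eventually.of_forall fun p => abs_ramp_quotient_le p.1 p.2 t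
  have hquot : ∀ x ∈ Ioo (0 : ℝ) 1, x ≠ t → ((a + b * x + doublePrimitive g x) -
      (a + b * t + doublePrimitive g t)) / (x - t) = b + ∫ s in Ioo (0 : ℝ) 1, ρ (x, s) := by
    intro x hx hxt
    have h0 : x - t ≠ 0 := sub_ne_zero.2 hxt
    have h1 : ∫ s in Ioo (0 : ℝ) 1, ρ (x, s) =
        (doublePrimitive g x - doublePrimitive g t) / (x - t) := by
      unfold doublePrimitive
      rw [← integral_sub (integrable_ramp_mul hg hx.2.le) (integrable_ramp_mul hg ht₁.le),
        ← integral_div]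
      refine integral_congr_ae (Eventually.of_forall fun s => ?_)
      simp only [hρ]
      ring
    rw [h1]
    field_simp
    ring
  have hae : ∀ᵐ x ∂(volume.restrict (Ioo (0 : ℝ) 1)), b + ∫ s in Ioo (0 : ℝ) 1, ρ (x, s) =
      ((a + b * x + doublePrimitive g x) - (a + b * t + doublePrimitive g t)) / (x - t) := by
    have : ∀ᵐ x ∂(volume.restrict (Ioo (0 : ℝ) 1)), x ≠ t :=
      ae_restrict_of_ae (Measure.ae_ne volume t)
    filter_upwards [ae_restrict_mem measurableSet_Ioo, this] with x hx hxt
    exact (hquot x hx hxt).symm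
  have hintx : Integrable (fun x => b + ∫ s in Ioo (0 : ℝ) 1, ρ (x, s))
      (volume.restrict (Ioo (0 : ℝ) 1)) := (integrable_const b).add hint.integral_prod_left
  have key := hasSingularIntegral_of_intervalIntegrable
    (φ := fun x => a + b * x + doublePrimitive g x) ht₀ ht₁ (by
      rw [intervalIntegrable_iff_integrableOn_Ioo_of_le zero_le_one]
      exact hintx.congr hae)
  convert key using 1
  rw [intervalIntegral.integral_of_le zero_le_one, integral_Ioc_eq_integral_Ioo,
    ← integral_congr_ae hae, integral_add (integrable_const b) hint.integral_prod_left,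
    integral_integral_swap hint]
  have h1 : ∀ s, singularKernel t s * g s =
      (∫ x in Ioo (0 : ℝ) 1, ρ (x, s)) + g₀ t * (max (t - s) 0 * g s) := by
    intro s
    simp only [hρ, integral_mul_const, singularKernel]
    ring
  simp_rw [h1]
  rw [integral_add hint.integral_prod_right ((integrable_ramp_mul hg ht₁.le).const_mul _),
    integral_const_mul]
  have h2 : ∫ _ in Ioo (0 : ℝ) 1, b = b := by simp
  rw [h2, g₁, ← g₀]
  unfold doublePrimitive
  ring

theorem hasSingularIntegral_id {t : ℝ} (ht₀ : 0 < t) (ht₁ : t < 1) :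
    HasSingularIntegral (fun x => x) t (g₁ t) := by
  simpa [doublePrimitive] using
    hasSingularIntegral_doublePrimitive (g := fun _ => 0) ht₀ ht₁ (by simp) 0 1

/-! ### The Sobolev space -/

/-- Smooth functions with compact support in `(0,1)`. -/
structure IsTest (ψ : ℝ → ℝ) : Prop where
  contDiff : ContDiff ℝ ∞ ψ
  hasCompactSupport : HasCompactSupport ψ
  tsupport_subset : tsupport ψ ⊆ Ioo (0 : ℝ) 1

theorem IsTest.deriv_isTest {ψ : ℝ → ℝ} (h : IsTest ψ) : IsTest (deriv ψ) :=
  ⟨(contDiff_infty_iff_deriv.1 h.contDiff).2, h.hasCompactSupport.deriv,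
    (tsupport_deriv_subset (𝕜 := ℝ)).trans h.tsupport_subset⟩

theorem IsTest.const_mul {ψ : ℝ → ℝ} (h : IsTest ψ) (c : ℝ) : IsTest (fun x => c * ψ x) :=
  ⟨contDiff_const.mul h.contDiff, h.hasCompactSupport.mul_left,
    (tsupport_mul_subset_right (f := fun _ => c) (g := ψ)).trans h.tsupport_subset⟩

theorem IsTest.add {ψ χ : ℝ → ℝ} (h : IsTest ψ) (h' : IsTest χ) :
    IsTest (fun x => ψ x + χ x) :=
  ⟨h.contDiff.add h'.contDiff, h.hasCompactSupport.add h'.hasCompactSupport,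
    (tsupport_add ψ χ).trans (union_subset h.tsupport_subset h'.tsupport_subset)⟩

theorem IsTest.differentiable {ψ : ℝ → ℝ} (h : IsTest ψ) : Differentiable ℝ ψ :=
  h.contDiff.differentiable (by simp)

theorem IsTest.continuous {ψ : ℝ → ℝ} (h : IsTest ψ) : Continuous ψ :=
  h.contDiff.continuous

theorem IsTest.eq_zero_of_notMem {ψ : ℝ → ℝ} (h : IsTest ψ) {x : ℝ} (hx : x ∉ Ioo (0 : ℝ) 1) :
    ψ x = 0 :=
  image_eq_zero_of_notMem_tsupport fun hx' => hx (h.tsupport_subset hx')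

theorem IsTest.exists_Icc {ψ : ℝ → ℝ} (h : IsTest ψ) :
    ∃ a b : ℝ, 0 < a ∧ a ≤ b ∧ b < 1 ∧ tsupport ψ ⊆ Icc a b := by
  rcases (tsupport ψ).eq_empty_or_nonempty with he | hne
  · exact ⟨1 / 2, 1 / 2, by norm_num, le_rfl, by norm_num, by simp [he]⟩
  · have hc : IsCompact (tsupport ψ) := h.hasCompactSupport
    have h1 := h.tsupport_subset (hc.sInf_mem hne)
    have h2 := h.tsupport_subset (hc.sSup_mem hne)
    exact ⟨sInf (tsupport ψ), sSup (tsupport ψ), h1.1,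
      csInf_le_csSup hne hc.bddBelow hc.bddAbove, h2.2, fun x hx =>
        ⟨csInf_le hc.bddBelow hx, le_csSup hc.bddAbove hx⟩⟩

theorem integral_mul_deriv_test {u u' ψ : ℝ → ℝ} (hu : ∀ x, HasDerivAt u (u' x) x)
    (hu' : Continuous u') (hψ : IsTest ψ) (a : ℝ) :
    ∫ x in a..(1 : ℝ), u x * deriv ψ x = -(u a * ψ a) - ∫ x in a..(1 : ℝ), u' x * ψ x := by
  rw [intervalIntegral.integral_mul_deriv_eq_deriv_mul (fun x _ => hu x)
    (fun x _ => (hψ.differentiable x).hasDerivAt) (hu'.intervalIntegrable _ _)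
    (hψ.deriv_isTest.continuous.intervalIntegrable _ _), hψ.eq_zero_of_notMem (x := 1) (by simp)]
  ring

/-- The primitive from 0 vanishes to the left of the support of `χ`, and to the right of it because
the total integral is zero. The support thus stays in the same compact interval inside `(0,1)`. -/
theorem IsTest.exists_primitive {χ : ℝ → ℝ} (h : IsTest χ)
    (h0 : ∫ x in (0 : ℝ)..1, χ x = 0) : ∃ ψ, IsTest ψ ∧ deriv ψ = χ := by
  obtain ⟨a, b, ha, hab, hb, hsub⟩ := h.exists_Icc
  have hz : ∀ x, x ∉ Icc a b → χ x = 0 := fun x hx =>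
    image_eq_zero_of_notMem_tsupport fun hx' => hx (hsub hx')
  set ψ : ℝ → ℝ := fun y => ∫ x in (0 : ℝ)..y, χ x with hψ
  have hd : ∀ x, HasDerivAt ψ (χ x) x := fun x =>
    intervalIntegral.integral_hasDerivAt_right (h.continuous.intervalIntegrable _ _)
      h.continuous.aestronglyMeasurable.stronglyMeasurableAtFilter h.continuous.continuousAt
  have hderiv : deriv ψ = χ := funext fun x => (hd x).deriv
  have hsupp : Function.support ψ ⊆ Icc a b := by
    intro y hy
    by_contra hyn
    apply hy
    rcases lt_or_ge y a with hlt | hge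
    · refine (intervalIntegral.integral_congr (g := fun _ => (0 : ℝ)) fun x hx => ?_).trans (by simp)
      refine hz x fun hx' => ?_
      have := hx.2
      rcases le_max_iff.1 this with h' | h' <;> linarith [hx'.1]
    · have hyb : b < y := by
        by_contra hle
        exact hyn ⟨hge, not_lt.1 hle⟩
      have hs : ψ y = (∫ x in (0 : ℝ)..1, χ x) + ∫ x in (1 : ℝ)..y, χ x :=
        (intervalIntegral.integral_add_adjacent_intervals (h.continuous.intervalIntegrable _ _)
          (h.continuous.intervalIntegrable _ _)).symm
      rw [hs, h0, zero_add]
      refine (intervalIntegral.integral_congr (g := fun _ => (0 : ℝ)) fun x hx => ?_).trans (by simp)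
      refine hz x fun hx' => ?_
      have := hx.1
      rcases min_le_iff.1 this with h' | h' <;> linarith [hx'.2]
  have hts : tsupport ψ ⊆ Icc a b := closure_minimal hsupp isClosed_Icc
  refine ⟨ψ, ⟨?_, ?_, ?_⟩, hderiv⟩
  · rw [contDiff_infty_iff_deriv, hderiv]
    exact ⟨fun x => (hd x).differentiableAt, h.contDiff⟩
  · exact HasCompactSupport.of_support_subset_isCompact isCompact_Icc hsupp
  · exact hts.trans fun x hx => ⟨ha.trans_le hx.1, hx.2.trans_lt hb⟩

theorem IsTest.exists_second_primitive {χ : ℝ → ℝ} (h : IsTest χ)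
    (h0 : ∫ x in (0 : ℝ)..1, χ x = 0) (h1 : ∫ x in (0 : ℝ)..1, x * χ x = 0) :
    ∃ ψ, IsTest ψ ∧ iteratedDeriv 2 ψ = χ := by
  obtain ⟨ψ₁, hψ₁, hd₁⟩ := h.exists_primitive h0
  obtain ⟨ψ, hψ, hd⟩ := hψ₁.exists_primitive (by
    have := integral_mul_deriv_test (u := fun x => x) (u' := fun _ => 1)
      (fun x => hasDerivAt_id x) continuous_const hψ₁ 0
    rw [hd₁, h1] at this
    simpa using this)
  refine ⟨ψ, hψ, ?_⟩
  rw [iteratedDeriv_succ, iteratedDeriv_one, hd, hd₁]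

theorem exists_isTest_integral_eq_one : ∃ η : ℝ → ℝ, IsTest η ∧ ∫ x in (0 : ℝ)..1, η x = 1 := by
  let B : ContDiffBump (1 / 2 : ℝ) := ⟨1 / 8, 1 / 4, by norm_num, by norm_num⟩
  have hsub : Metric.closedBall (1 / 2 : ℝ) (1 / 4) ⊆ Ioo 0 1 := by
    rw [Real.closedBall_eq_Icc]
    intro x hx
    exact ⟨by linarith [hx.1], by linarith [hx.2]⟩
  have ht : IsTest (B.normed volume) :=
    ⟨B.contDiff_normed, B.hasCompactSupport_normed, by
      rw [B.tsupport_normed_eq]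
      exact hsub⟩
  refine ⟨_, ht, ?_⟩
  rw [intervalIntegral.integral_of_le zero_le_one, integral_Ioc_eq_integral_Ioo,
    setIntegral_eq_integral_of_forall_compl_eq_zero fun x hx => ht.eq_zero_of_notMem hx,
    B.integral_normed]

/-- A du Bois-Reymond lemma of second order. A test function is a second derivative of a test
function as soon as its moments of order 0 and 1 vanish, and any `χ` can be corrected to this form
by multiples of `η` and `deriv η`. So `∫ w χ` depends only on the two moments of `χ`, as it does for
an affine `w`. -/
theorem eqOn_affine_of_integral_mul_eq_zero {w : ℝ → ℝ} (hw : ContinuousOn w (Icc 0 1))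
    (h : ∀ ψ, IsTest ψ → ∫ x in (0 : ℝ)..1, w x * iteratedDeriv 2 ψ x = 0) :
    ∃ a b : ℝ, EqOn w (fun x => a + b * x) (Icc 0 1) := by
  obtain ⟨η, hη, hη1⟩ := exists_isTest_integral_eq_one
  set m : ℝ := ∫ x in (0 : ℝ)..1, x * η x with hm
  have hη' := hη.deriv_isTest
  have hd0 : ∫ x in (0 : ℝ)..1, deriv η x = 0 := by
    have := integral_mul_deriv_test (u := fun _ => 1) (u' := fun _ => 0)
      (fun x => hasDerivAt_const x 1) continuous_const hη 0
    simpa [hη.eq_zero_of_notMem (x := 0) (by simp)] using this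
  have hd1 : ∫ x in (0 : ℝ)..1, x * deriv η x = -1 := by
    have := integral_mul_deriv_test (u := fun x => x) (u' := fun _ => 1)
      (fun x => hasDerivAt_id x) continuous_const hη 0
    simpa [hη1] using this
  have hwi : ∀ χ : ℝ → ℝ, IsTest χ → IntervalIntegrable (fun x => w x * χ x) volume 0 1 := by
    intro χ hχ
    apply ContinuousOn.intervalIntegrable
    rw [uIcc_of_le zero_le_one]
    exact hw.mul hχ.continuous.continuousOn
  set P : ℝ := ∫ x in (0 : ℝ)..1, w x * η x with hP
  set Q : ℝ := ∫ x in (0 : ℝ)..1, w x * deriv η x with hQ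
  refine ⟨P + m * Q, -Q, ?_⟩
  have hci : ∀ χ : ℝ → ℝ, IsTest χ → IntervalIntegrable χ volume 0 1 := fun χ hχ =>
    hχ.continuous.intervalIntegrable _ _
  have hxi : ∀ χ : ℝ → ℝ, IsTest χ → IntervalIntegrable (fun x => x * χ x) volume 0 1 :=
    fun χ hχ => (continuous_id.mul hχ.continuous).intervalIntegrable _ _
  have hlin : ∀ χ : ℝ → ℝ, IsTest χ → ∫ x in (0 : ℝ)..1, w x * χ x =
      (P + m * Q) * (∫ x in (0 : ℝ)..1, χ x) + (-Q) * ∫ x in (0 : ℝ)..1, x * χ x := by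
    intro χ hχ
    set c₀ : ℝ := ∫ x in (0 : ℝ)..1, χ x with hc₀
    set c₁ : ℝ := ∫ x in (0 : ℝ)..1, x * χ x with hc₁
    -- The moments of order 0 and 1 are `1, m` for `η`, `0, -1` for `deriv η` and `c₀, c₁` for `χ`;
    -- these weights cancel both.
    have ht : IsTest (fun x => χ x + (-c₀ * η x + (c₁ - m * c₀) * deriv η x)) :=
      hχ.add ((hη.const_mul _).add (hη'.const_mul _))
    obtain ⟨ψ, hψ, hψχ⟩ := ht.exists_second_primitive
      (by
        rw [intervalIntegral.integral_add (hci _ hχ)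
            (hci _ ((hη.const_mul _).add (hη'.const_mul _))),
          intervalIntegral.integral_add (hci _ (hη.const_mul _)) (hci _ (hη'.const_mul _)),
          intervalIntegral.integral_const_mul, intervalIntegral.integral_const_mul, hη1, hd0]
        ring)
      (by
        have e : ∀ x, x * (χ x + (-c₀ * η x + (c₁ - m * c₀) * deriv η x)) =
          x * χ x + (-c₀ * (x * η x) + (c₁ - m * c₀) * (x * deriv η x)) := fun x => by ring
        simp_rw [e]
        rw [intervalIntegral.integral_add (hxi _ hχ)
            (((hxi _ hη).const_mul _).add ((hxi _ hη').const_mul _)),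
          intervalIntegral.integral_add ((hxi _ hη).const_mul _) ((hxi _ hη').const_mul _),
          intervalIntegral.integral_const_mul, intervalIntegral.integral_const_mul, hd1]
        ring)
    have h' := h ψ hψ
    rw [hψχ] at h'
    have e : ∀ x, w x * (χ x + (-c₀ * η x + (c₁ - m * c₀) * deriv η x)) =
      w x * χ x + (-c₀ * (w x * η x) + (c₁ - m * c₀) * (w x * deriv η x)) := fun x => by ring
    simp_rw [e] at h'
    rw [intervalIntegral.integral_add (hwi _ hχ)
        (((hwi _ hη).const_mul _).add ((hwi _ hη').const_mul _)),
      intervalIntegral.integral_add ((hwi _ hη).const_mul _) ((hwi _ hη').const_mul _),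
      intervalIntegral.integral_const_mul, intervalIntegral.integral_const_mul, ← hP, ← hQ] at h'
    linear_combination h'
  set v : ℝ → ℝ := fun x => w x - ((P + m * Q) + -Q * x) with hv
  have hvc : ContinuousOn v (Icc 0 1) := hw.sub (by fun_prop)
  have hae : ∀ᵐ x ∂volume, x ∈ Ioo (0 : ℝ) 1 → v x = 0 := by
    refine isOpen_Ioo.ae_eq_zero_of_integral_contDiff_smul_eq_zero
      ((hvc.mono Ioo_subset_Icc_self).locallyIntegrableOn measurableSet_Ioo) ?_
    intro χ h1 h2 h3
    have hχ : IsTest χ := ⟨h1, h2, h3⟩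
    rw [← setIntegral_eq_integral_of_forall_compl_eq_zero (s := Ioo (0 : ℝ) 1)
      (fun x hx => by simp [hχ.eq_zero_of_notMem hx]), ← integral_Ioc_eq_integral_Ioo,
      ← intervalIntegral.integral_of_le zero_le_one]
    have e : ∀ x, χ x • v x = w x * χ x - ((P + m * Q) * χ x + -Q * (x * χ x)) := fun x => by
      simp only [hv, smul_eq_mul]
      ring
    simp_rw [e]
    rw [intervalIntegral.integral_sub (hwi _ hχ)
        (((hci _ hχ).const_mul _).add ((hxi _ hχ).const_mul _)),
      intervalIntegral.integral_add ((hci _ hχ).const_mul _) ((hxi _ hχ).const_mul _),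
      intervalIntegral.integral_const_mul, intervalIntegral.integral_const_mul, hlin χ hχ]
    ring
  refine Measure.eqOn_Icc_of_ae_eq volume (zero_ne_one' ℝ) ?_ hw (by fun_prop)
  rw [← restrict_Ioo_eq_restrict_Icc]
  rw [EventuallyEq, ae_restrict_iff' measurableSet_Ioo]
  filter_upwards [hae] with x hx hx'
  exact sub_eq_zero.1 (hx hx')

theorem continuousOn_doublePrimitive {g : ℝ → ℝ} (hg : IntegrableOn g (Ioo 0 1)) :
    ContinuousOn (doublePrimitive g) (Icc 0 1) := by
  refine continuousOn_of_dominated (bound := fun s => |g s|) ?_ ?_ hg.abs ?_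
  · intro x hx
    exact (integrable_ramp_mul hg hx.2).aestronglyMeasurable
  · intro x hx
    filter_upwards [ae_restrict_mem measurableSet_Ioo] with s hs
    rw [Real.norm_eq_abs, abs_mul]
    exact mul_le_of_le_one_left (abs_nonneg _) (ramp_nonneg_le hx.2 hs.1.le)
  · exact Eventually.of_forall fun s => by fun_prop

/-- The ramp is a fundamental solution of the second derivative: integrate by parts twice on `[s,
1]`. -/
theorem integral_ramp_mul_iteratedDeriv {ψ : ℝ → ℝ} (hψ : IsTest ψ) {s : ℝ}
    (hs : s ∈ Ioo (0 : ℝ) 1) :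
    ∫ x in Ioo (0 : ℝ) 1, max (x - s) 0 * iteratedDeriv 2 ψ x = ψ s := by
  have hψ2 : iteratedDeriv 2 ψ = deriv (deriv ψ) := by
    rw [iteratedDeriv_succ, iteratedDeriv_one]
  have hc : Continuous fun x => max (x - s) 0 * deriv (deriv ψ) x :=
    Continuous.mul (by fun_prop) hψ.deriv_isTest.deriv_isTest.continuous
  rw [hψ2, ← integral_Ioc_eq_integral_Ioo, ← intervalIntegral.integral_of_le zero_le_one,
    ← intervalIntegral.integral_add_adjacent_intervals (b := s) (hc.intervalIntegrable _ _)
      (hc.intervalIntegrable _ _)]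
  have h1 : ∫ x in (0 : ℝ)..s, max (x - s) 0 * deriv (deriv ψ) x = 0 := by
    refine (intervalIntegral.integral_congr (g := fun _ => (0 : ℝ)) fun x hx => ?_).trans (by simp)
    rw [uIcc_of_le hs.1.le] at hx
    simp [max_eq_right (sub_nonpos.2 hx.2)]
  have h2 : ∫ x in s..(1 : ℝ), max (x - s) 0 * deriv (deriv ψ) x =
      ∫ x in s..(1 : ℝ), (x - s) * deriv (deriv ψ) x := by
    refine intervalIntegral.integral_congr fun x hx => ?_
    rw [uIcc_of_le hs.2.le] at hx
    simp only [max_eq_left (sub_nonneg.2 hx.1)]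
  rw [h1, h2, integral_mul_deriv_test (u := fun x => x - s) (u' := fun _ => 1)
    (fun x => (hasDerivAt_id x).sub_const s) continuous_const hψ.deriv_isTest]
  have h3 := integral_mul_deriv_test (u := fun _ => 1) (u' := fun _ => 0)
      (fun x => hasDerivAt_const x 1) continuous_const hψ s
  simp only [one_mul, zero_mul, intervalIntegral.integral_zero] at h3 ⊢
  rw [h3]
  ring

theorem isWeakSecondDeriv_doublePrimitive {g : ℝ → ℝ} (hg : IntegrableOn g (Ioo 0 1)) :
    IsWeakSecondDeriv (doublePrimitive g) g := by
  intro ψ h1 h2 h3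
  have hψ : IsTest ψ := ⟨h1, h2, h3⟩
  have hψ2 : iteratedDeriv 2 ψ = deriv (deriv ψ) := by
    rw [iteratedDeriv_succ, iteratedDeriv_one]
  have hint : Integrable (fun p : ℝ × ℝ => max (p.1 - p.2) 0 * (iteratedDeriv 2 ψ p.1 * g p.2))
      ((volume.restrict (Ioo (0 : ℝ) 1)).prod (volume.restrict (Ioo (0 : ℝ) 1))) := by
    refine Integrable.bdd_mul (c := 1) ?_ ?_ ?_
    · refine Integrable.mul_prod ?_ hg
      rw [hψ2]
      exact (hψ.deriv_isTest.deriv_isTest.continuous.integrable_of_hasCompactSupport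
        hψ.deriv_isTest.deriv_isTest.hasCompactSupport).integrableOn
    · apply Continuous.aestronglyMeasurable
      fun_prop
    · rw [Measure.prod_restrict]
      filter_upwards [ae_restrict_mem (measurableSet_Ioo.prod measurableSet_Ioo)] with p hp
      exact ramp_nonneg_le hp.1.2.le hp.2.1.le
  calc ∫ x in Ioo (0 : ℝ) 1, doublePrimitive g x * iteratedDeriv 2 ψ x
      = ∫ x in Ioo (0 : ℝ) 1, ∫ s in Ioo (0 : ℝ) 1,
          max (x - s) 0 * (iteratedDeriv 2 ψ x * g s) := by
        refine integral_congr_ae (Eventually.of_forall fun x => ?_)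
        simp only [doublePrimitive]
        rw [← integral_mul_const]
        refine integral_congr_ae (Eventually.of_forall fun s => ?_)
        ring
    _ = ∫ s in Ioo (0 : ℝ) 1, ∫ x in Ioo (0 : ℝ) 1,
          max (x - s) 0 * (iteratedDeriv 2 ψ x * g s) := integral_integral_swap hint
    _ = ∫ s in Ioo (0 : ℝ) 1, g s * ψ s := by
        refine setIntegral_congr_fun measurableSet_Ioo fun s hs => ?_
        rw [← integral_ramp_mul_iteratedDeriv hψ hs, mul_comm (g s), ← integral_mul_const]
        refine integral_congr_ae (Eventually.of_forall fun x => ?_)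
        ring

theorem integrableOn_of_memLp_two {g : ℝ → ℝ} (hg : MemLp g 2 (volume.restrict (Ioo (0 : ℝ) 1))) :
    IntegrableOn g (Ioo 0 1) :=
  hg.integrable (by norm_num)

theorem memSobolevWith_doublePrimitive {g : ℝ → ℝ}
    (hg : MemLp g 2 (volume.restrict (Ioo (0 : ℝ) 1))) :
    MemSobolevWith (doublePrimitive g) g :=
  ⟨continuousOn_doublePrimitive (integrableOn_of_memLp_two hg), hg,
    isWeakSecondDeriv_doublePrimitive (integrableOn_of_memLp_two hg)⟩

/-- The difference of `φ` and `doublePrimitive g` is continuous with weak second derivative zero,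
hence affine. -/
theorem MemSobolevWith.exists_eqOn {φ g : ℝ → ℝ} (h : MemSobolevWith φ g) :
    ∃ a b : ℝ, EqOn φ (fun x => a + b * x + doublePrimitive g x) (Icc 0 1) := by
  have hd := memSobolevWith_doublePrimitive h.memLp
  obtain ⟨a, b, hab⟩ := eqOn_affine_of_integral_mul_eq_zero
    (h.continuousOn.sub hd.continuousOn) (by
      intro ψ hψ
      have hψ2 : iteratedDeriv 2 ψ = deriv (deriv ψ) := by
        rw [iteratedDeriv_succ, iteratedDeriv_one]
      have hi : ∀ {v : ℝ → ℝ}, ContinuousOn v (Icc 0 1) →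
          IntegrableOn (fun x => v x * iteratedDeriv 2 ψ x) (Ioo 0 1) := fun hv => by
        rw [hψ2]
        exact ((hv.mul hψ.deriv_isTest.deriv_isTest.continuous.continuousOn).integrableOn_Icc).mono_set
          Ioo_subset_Icc_self
      rw [intervalIntegral.integral_of_le zero_le_one, integral_Ioc_eq_integral_Ioo]
      simp_rw [Pi.sub_apply, sub_mul]
      rw [integral_sub (hi h.continuousOn) (hi hd.continuousOn),
        h.weakDeriv ψ hψ.1 hψ.2 hψ.3, hd.weakDeriv ψ hψ.1 hψ.2 hψ.3, sub_self])
  refine ⟨a, b, fun x hx => ?_⟩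
  have := hab hx
  simp only [Pi.sub_apply] at this ⊢
  linarith

/-! ### The closed form of `f` -/

/-- The integrand is the quotient of `(x - y)^3 - (t - y)^3` by `x - t`. -/
theorem integral_cubic_quotient (y t a b : ℝ) :
    ∫ x in a..b, ((x - y) ^ 2 + (x - y) * (t - y) + (t - y) ^ 2) =
      ((b - y) ^ 3 / 3 + (b - y) ^ 2 / 2 * (t - y) + (t - y) ^ 2 * b) -
        ((a - y) ^ 3 / 3 + (a - y) ^ 2 / 2 * (t - y) + (t - y) ^ 2 * a) := by
  refine intervalIntegral.integral_eq_sub_of_hasDerivAt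
    (f := fun x => (x - y) ^ 3 / 3 + (x - y) ^ 2 / 2 * (t - y) + (t - y) ^ 2 * x)
    (fun x _ => ?_) (Continuous.intervalIntegrable (by fun_prop) _ _)
  have h := (hasDerivAt_id x).sub_const y
  refine ((((h.pow 3).div_const 3).add (((h.pow 2).div_const 2).mul_const (t - y))).add
    ((hasDerivAt_id x).const_mul ((t - y) ^ 2))).congr_deriv ?_
  simp

/-- Split at `y`. On the side containing `t` the difference of cubes is divisible by `x - t`, and
the difference quotient is `Q` up to sign. On the other side the change of sign leaves an extra `±2
(t - y)^3 / (x - t)`, which is not singular there and accounts for the logarithm of `|y - t|`. -/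
theorem hasSingularIntegral_abs_cubed {y t : ℝ} (hy₀ : 0 ≤ y) (hy₁ : y ≤ 1) (ht₀ : 0 < t)
    (ht₁ : t < 1) (hyt : t ≠ y) :
    HasSingularIntegral (fun x => |x - y| ^ 3) t (12 * f y t) := by
  set Q : ℝ → ℝ := fun x => (x - y) ^ 2 + (x - y) * (t - y) + (t - y) ^ 2 with hQ
  set ρ : ℝ → ℝ := fun x => (|x - y| ^ 3 - |t - y| ^ 3) / (x - t) with hρ
  have hlog : Real.log (t - t ^ 2) = Real.log t + Real.log (1 - t) := by
    rw [show t - t ^ 2 = t * (1 - t) by ring, Real.log_mul ht₀.ne' (by linarith)]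
  have hg : g₀ t = Real.log (1 - t) - Real.log t := by
    rw [g₀, Real.log_div (by linarith) ht₀.ne']
  have hQi : ∀ a b, IntervalIntegrable Q volume a b := fun a b =>
    Continuous.intervalIntegrable (by fun_prop) _ _
  have hne : ∀ᵐ x : ℝ ∂volume, x ≠ t := Measure.ae_ne volume t
  suffices H : IntervalIntegrable ρ volume 0 1 ∧
      (∫ x in (0 : ℝ)..1, ρ x) + |t - y| ^ 3 * g₀ t = 12 * f y t by
    have := hasSingularIntegral_of_intervalIntegrable (φ := fun x => |x - y| ^ 3) ht₀ ht₁ H.1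
    rwa [← H.2]
  rcases lt_or_gt_of_ne hyt with hlt | hgt
  · have e1 : ∀ᵐ x : ℝ ∂volume, x ∈ uIoc 0 y → -Q x = ρ x := by
      filter_upwards [hne] with x hx hxm
      rw [uIoc_of_le hy₀] at hxm
      have : x - t ≠ 0 := sub_ne_zero.2 hx
      simp only [hρ, hQ, abs_of_nonpos (sub_nonpos.2 hxm.2), abs_of_neg (sub_neg.2 hlt)]
      field_simp
      ring
    have e2 : ∀ᵐ x : ℝ ∂volume, x ∈ uIoc y 1 → Q x + 2 * (t - y) ^ 3 * (x - t)⁻¹ = ρ x := by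
      filter_upwards [hne] with x hx hxm
      rw [uIoc_of_le hy₁] at hxm
      have : x - t ≠ 0 := sub_ne_zero.2 hx
      simp only [hρ, hQ, abs_of_pos (sub_pos.2 hxm.1), abs_of_neg (sub_neg.2 hlt)]
      field_simp
      ring
    have hinv : IntervalIntegrable (fun x => (x - t)⁻¹) volume y 1 :=
      intervalIntegrable_sub_inv (by
        rw [uIcc_of_le hy₁]
        exact fun h => absurd h.1 (not_le.2 hlt))
    have i1 : IntervalIntegrable ρ volume 0 y :=
      (hQi 0 y).neg.congr_ae ((ae_restrict_iff' measurableSet_uIoc).2 e1)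
    have i2 : IntervalIntegrable ρ volume y 1 :=
      ((hQi y 1).add (hinv.const_mul (2 * (t - y) ^ 3))).congr_ae
        ((ae_restrict_iff' measurableSet_uIoc).2 e2)
    refine ⟨i1.trans i2, ?_⟩
    have hI : ∫ x in y..(1 : ℝ), (x - t)⁻¹ = Real.log (1 - t) - Real.log (y - t) := by
      rw [intervalIntegral.integral_comp_sub_right (fun x => x⁻¹) t,
        integral_inv_of_pos (by linarith) (by linarith), Real.log_div (by linarith) (by linarith)]
    rw [← intervalIntegral.integral_add_adjacent_intervals i1 i2,
      ← intervalIntegral.integral_congr_ae e1, ← intervalIntegral.integral_congr_ae e2,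
      intervalIntegral.integral_neg, intervalIntegral.integral_add (hQi y 1) (hinv.const_mul _),
      intervalIntegral.integral_const_mul, hI, integral_cubic_quotient, integral_cubic_quotient,
      f, hlog, hg, abs_of_neg (sub_neg.2 hlt), abs_of_pos (sub_pos.2 hlt)]
    ring
  · have e1 : ∀ᵐ x : ℝ ∂volume, x ∈ uIoc 0 y → -Q x + -2 * (t - y) ^ 3 * (x - t)⁻¹ = ρ x := by
      filter_upwards [hne] with x hx hxm
      rw [uIoc_of_le hy₀] at hxm
      have : x - t ≠ 0 := sub_ne_zero.2 hx
      simp only [hρ, hQ, abs_of_nonpos (sub_nonpos.2 hxm.2), abs_of_pos (sub_pos.2 hgt)]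
      field_simp
      ring
    have e2 : ∀ᵐ x : ℝ ∂volume, x ∈ uIoc y 1 → Q x = ρ x := by
      filter_upwards [hne] with x hx hxm
      rw [uIoc_of_le hy₁] at hxm
      have : x - t ≠ 0 := sub_ne_zero.2 hx
      simp only [hρ, hQ, abs_of_pos (sub_pos.2 hxm.1), abs_of_pos (sub_pos.2 hgt)]
      field_simp
      ring
    have hinv : IntervalIntegrable (fun x => (x - t)⁻¹) volume 0 y :=
      intervalIntegrable_sub_inv (by
        rw [uIcc_of_le hy₀]
        exact fun h => absurd h.2 (not_le.2 hgt))
    have i1 : IntervalIntegrable ρ volume 0 y :=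
      ((hQi 0 y).neg.add (hinv.const_mul (-2 * (t - y) ^ 3))).congr_ae
        ((ae_restrict_iff' measurableSet_uIoc).2 e1)
    have i2 : IntervalIntegrable ρ volume y 1 :=
      (hQi y 1).congr_ae ((ae_restrict_iff' measurableSet_uIoc).2 e2)
    refine ⟨i1.trans i2, ?_⟩
    have hI : ∫ x in (0 : ℝ)..y, (x - t)⁻¹ = Real.log (t - y) - Real.log t := by
      rw [intervalIntegral.integral_comp_sub_right (fun x => x⁻¹) t,
        integral_inv_of_neg (by linarith) (by linarith), ← neg_div_neg_eq,
        Real.log_div (by linarith) (by linarith)]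
      simp
    have hn : IntervalIntegrable (fun x => -Q x) volume 0 y := (hQi 0 y).neg
    rw [← intervalIntegral.integral_add_adjacent_intervals i1 i2,
      ← intervalIntegral.integral_congr_ae e1, ← intervalIntegral.integral_congr_ae e2,
      intervalIntegral.integral_add hn (hinv.const_mul _),
      intervalIntegral.integral_neg,
      intervalIntegral.integral_const_mul, hI, integral_cubic_quotient, integral_cubic_quotient,
      f, hlog, hg, abs_of_neg (sub_neg.2 hgt), abs_of_pos (sub_pos.2 hgt)]
    ring_nf

/-! ### The norm of the error functional -/

theorem step_mul_mem_Icc {N β : ℕ} (hN : N ≠ 0) (hβ : β ≤ N) :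
    step N * (β : ℝ) ∈ Icc (0 : ℝ) 1 := by
  have : (0 : ℝ) < N := by positivity
  have h : (β : ℝ) ≤ N := by exact_mod_cast hβ
  rw [step, one_div_mul_eq_div]
  exact ⟨by positivity, (div_le_one this).2 h⟩

/-- The kernel representing the error functional on functions vanishing to first order at `0`. -/
noncomputable def errorKernel (N : ℕ) (t : ℝ) (C : Fin (N + 1) → ℝ) (s : ℝ) : ℝ :=
  singularKernel t s - ∑ β : Fin (N + 1), C β * max (step N * (β : ℕ) - s) 0

theorem stronglyMeasurable_errorKernel (N : ℕ) (t : ℝ) (C : Fin (N + 1) → ℝ) :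
    StronglyMeasurable (errorKernel N t C) :=
  (stronglyMeasurable_singularKernel t).sub (Measurable.stronglyMeasurable (by fun_prop))

theorem exists_abs_errorKernel_le {N : ℕ} {t : ℝ} (hN : N ≠ 0) (ht₁ : t < 1)
    (C : Fin (N + 1) → ℝ) : ∃ M, ∀ s ∈ Ioo (0 : ℝ) 1, |errorKernel N t C s| ≤ M := by
  refine ⟨(1 + |g₀ t|) + ∑ β, |C β|, fun s hs => (abs_sub _ _).trans (add_le_add ?_ ?_)⟩
  · exact abs_singularKernel_le ht₁ hs.1.le
  · refine (Finset.abs_sum_le_sum_abs _ _).trans (Finset.sum_le_sum fun β _ => ?_)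
    rw [abs_mul]
    exact mul_le_of_le_one_right (abs_nonneg _)
      (ramp_nonneg_le (step_mul_mem_Icc hN (Nat.lt_succ_iff.1 β.2)).2 hs.1.le)

theorem memLp_errorKernel {N : ℕ} {t : ℝ} (hN : N ≠ 0) (ht₁ : t < 1) (C : Fin (N + 1) → ℝ) :
    MemLp (errorKernel N t C) 2 (volume.restrict (Ioo (0 : ℝ) 1)) := by
  obtain ⟨M, hM⟩ := exists_abs_errorKernel_le hN ht₁ C
  refine MemLp.of_bound (stronglyMeasurable_errorKernel N t C).aestronglyMeasurable M ?_
  filter_upwards [ae_restrict_mem measurableSet_Ioo] with s hs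
  exact hM s hs

theorem quadError_eq {N : ℕ} {t : ℝ} (hN : N ≠ 0) (ht₀ : 0 < t) (ht₁ : t < 1)
    (C : Fin (N + 1) → ℝ) {φ g : ℝ → ℝ} (hg : IntegrableOn g (Ioo 0 1)) {a b : ℝ}
    (h : EqOn φ (fun x => a + b * x + doublePrimitive g x) (Icc 0 1)) :
    quadError N t C φ = a * (g₀ t - ∑ γ, C γ) + b * (g₁ t - ∑ γ, C γ * (step N * (γ : ℕ))) +
      ∫ s in Ioo (0 : ℝ) 1, errorKernel N t C s * g s := by
  have hmem : ∀ β : Fin (N + 1), step N * ((β : ℕ) : ℝ) ∈ Icc (0 : ℝ) 1 := fun β =>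
    step_mul_mem_Icc hN (Nat.lt_succ_iff.1 β.2)
  have hs := ((hasSingularIntegral_doublePrimitive ht₀ ht₁ hg a b).congr ht₀ ht₁
    h.symm).singularIntegral_eq
  have hk : Integrable (fun s => singularKernel t s * g s) (volume.restrict (Ioo (0 : ℝ) 1)) := by
    refine Integrable.bdd_mul (c := 1 + |g₀ t|) hg
      (stronglyMeasurable_singularKernel t).aestronglyMeasurable ?_
    filter_upwards [ae_restrict_mem measurableSet_Ioo] with s hs
    exact abs_singularKernel_le ht₁ hs.1.le
  have hr : ∀ β : Fin (N + 1), Integrable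
      (fun s => C β * (max (step N * (β : ℕ) - s) 0 * g s)) (volume.restrict (Ioo (0 : ℝ) 1)) :=
    fun β => (integrable_ramp_mul hg (hmem β).2).const_mul _
  have he : ∀ s, errorKernel N t C s * g s = singularKernel t s * g s -
      ∑ β : Fin (N + 1), C β * (max (step N * (β : ℕ) - s) 0 * g s) := by
    intro s
    rw [errorKernel, sub_mul, Finset.sum_mul]
    simp_rw [mul_assoc]
  simp_rw [he]
  rw [integral_sub hk (integrable_finsetSum _ fun β _ => hr β),
    integral_finsetSum _ fun β _ => hr β]
  simp_rw [integral_const_mul]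
  rw [quadError, hs]
  have hsum : ∑ β : Fin (N + 1), C β * φ (step N * (β : ℕ)) =
      a * ∑ γ, C γ + b * ∑ γ, C γ * (step N * (γ : ℕ)) +
      ∑ β : Fin (N + 1), C β * doublePrimitive g (step N * (β : ℕ)) := by
    rw [Finset.mul_sum, Finset.mul_sum, ← Finset.sum_add_distrib, ← Finset.sum_add_distrib]
    refine Finset.sum_congr rfl fun β _ => ?_
    rw [h (hmem β)]
    ring
  rw [hsum]
  unfold doublePrimitive
  ring

theorem memSobolevWith_affine (a b : ℝ) : MemSobolevWith (fun x => a + b * x) (fun _ => 0) := by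
  refine ⟨by fun_prop, MemLp.zero', ?_⟩
  intro ψ h1 h2 h3
  have hψ : IsTest ψ := ⟨h1, h2, h3⟩
  have hψ2 : iteratedDeriv 2 ψ = deriv (deriv ψ) := by
    rw [iteratedDeriv_succ, iteratedDeriv_one]
  rw [hψ2, ← integral_Ioc_eq_integral_Ioo, ← intervalIntegral.integral_of_le zero_le_one,
    integral_mul_deriv_test (u := fun x => a + b * x) (u' := fun _ => b)
      (fun x => by simpa using ((hasDerivAt_id x).const_mul b).const_add a) continuous_const
      hψ.deriv_isTest,
    integral_mul_deriv_test (u := fun _ => b) (u' := fun _ => 0)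
      (fun x => hasDerivAt_const x b) continuous_const hψ,
    hψ.eq_zero_of_notMem (x := 0) (by simp), hψ.deriv_isTest.eq_zero_of_notMem (x := 0) (by simp)]
  simp

theorem le_errorNorm {N : ℕ} {t : ℝ} {C : Fin (N + 1) → ℝ} {φ g : ℝ → ℝ} (h : MemSobolevWith φ g)
    (hg : eLpNorm g 2 (volume.restrict (Ioo (0 : ℝ) 1)) ≤ 1) :
    ENNReal.ofReal |quadError N t C φ| ≤ errorNorm N t C :=
  le_iSup_of_le φ (le_iSup_of_le g (le_iSup_of_le h (le_iSup_of_le hg le_rfl)))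

/-- Affine functions have seminorm zero, so all their multiples compete in the supremum; a finite
norm forces the error to vanish on them. -/
theorem exactness_of_errorNorm_lt_top {N : ℕ} {t : ℝ} (hN : N ≠ 0) (ht₀ : 0 < t) (ht₁ : t < 1)
    {C : Fin (N + 1) → ℝ} (h : errorNorm N t C < ⊤) :
    ∑ γ, C γ = g₀ t ∧ ∑ γ, C γ * (step N * (γ : ℕ)) = g₁ t := by
  have key : ∀ a b : ℝ, |a * (g₀ t - ∑ γ, C γ) + b * (g₁ t - ∑ γ, C γ * (step N * (γ : ℕ)))| ≤
      (errorNorm N t C).toReal := by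
    intro a b
    have h1 := le_errorNorm (N := N) (t := t) (C := C) (memSobolevWith_affine a b) (by simp)
    rw [quadError_eq hN ht₀ ht₁ C (g := fun _ => 0) (a := a) (b := b) (by simp)
      (fun x _ => by simp [doublePrimitive])] at h1
    simpa using (ENNReal.ofReal_le_iff_le_toReal h.ne).1 h1
  have zero_of_bdd : ∀ x : ℝ, (∀ a : ℝ, |a * x| ≤ (errorNorm N t C).toReal) → x = 0 := by
    intro x hx
    by_contra h0
    have := hx (((errorNorm N t C).toReal + 1) / x)
    rw [div_mul_cancel₀ _ h0, abs_of_nonneg (by positivity)] at this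
    linarith
  constructor
  · exact (sub_eq_zero.1 (zero_of_bdd _ fun a => by simpa using key a 0)).symm
  · exact (sub_eq_zero.1 (zero_of_bdd _ fun b => by simpa using key 0 b)).symm

theorem eLpNorm_two_eq_ofReal_sqrt {α : Type*} [MeasurableSpace α] {μ : Measure α} {g : α → ℝ}
    (hg : MemLp g 2 μ) : eLpNorm g 2 μ = ENNReal.ofReal √(∫ x, g x ^ 2 ∂μ) := by
  rw [hg.eLpNorm_eq_integral_rpow_norm (by norm_num) (by norm_num), Real.sqrt_eq_rpow]
  simp

/-- Cauchy-Schwarz bounds the norm from above. The bound is attained at the double primitive of the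
normalized kernel. -/
theorem errorNorm_eq {N : ℕ} {t : ℝ} (hN : N ≠ 0) (ht₀ : 0 < t) (ht₁ : t < 1)
    {C : Fin (N + 1) → ℝ} (h₀ : ∑ γ, C γ = g₀ t) (h₁ : ∑ γ, C γ * (step N * (γ : ℕ)) = g₁ t) :
    errorNorm N t C = ENNReal.ofReal √(∫ s in Ioo (0 : ℝ) 1, errorKernel N t C s ^ 2) := by
  have hK := memLp_errorKernel hN ht₁ C
  have hrep : ∀ {φ g : ℝ → ℝ} {a b : ℝ}, IntegrableOn g (Ioo 0 1) →
      EqOn φ (fun x => a + b * x + doublePrimitive g x) (Icc 0 1) →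
      quadError N t C φ = ∫ s in Ioo (0 : ℝ) 1, errorKernel N t C s * g s := by
    intro φ g a b hg h
    rw [quadError_eq hN ht₀ ht₁ C hg h, h₀, h₁]
    ring
  apply le_antisymm
  · refine iSup_le fun φ => iSup_le fun g => iSup_le fun h => iSup_le fun hg => ?_
    obtain ⟨a, b, hab⟩ := h.exists_eqOn
    rw [hrep (integrableOn_of_memLp_two h.memLp) hab, ← eLpNorm_two_eq_ofReal_sqrt hK,
      ← Real.enorm_eq_ofReal_abs]
    calc ‖∫ s in Ioo (0 : ℝ) 1, errorKernel N t C s * g s‖ₑ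
        ≤ ∫⁻ s in Ioo (0 : ℝ) 1, ‖errorKernel N t C s * g s‖ₑ :=
          enorm_integral_le_lintegral_enorm _
      _ = eLpNorm (errorKernel N t C • g) 1 (volume.restrict (Ioo (0 : ℝ) 1)) := by
          rw [eLpNorm_one_eq_lintegral_enorm]
          rfl
      _ ≤ eLpNorm (errorKernel N t C) 2 (volume.restrict (Ioo (0 : ℝ) 1)) *
            eLpNorm g 2 (volume.restrict (Ioo (0 : ℝ) 1)) :=
          eLpNorm_smul_le_mul_eLpNorm h.memLp.1 hK.1
      _ ≤ _ := mul_le_of_le_one_right' hg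
  · set S : ℝ := ∫ s in Ioo (0 : ℝ) 1, errorKernel N t C s ^ 2 with hS
    have hS0 : 0 ≤ S := integral_nonneg fun s => sq_nonneg _
    rcases hS0.eq_or_lt with h0 | hpos
    · simp [← h0]
    have hsq : 0 < √S := Real.sqrt_pos.2 hpos
    have hsS : √S ^ 2 = S := Real.sq_sqrt hS0
    have hg : MemLp (fun s => (√S)⁻¹ * errorKernel N t C s) 2 (volume.restrict (Ioo (0 : ℝ) 1)) :=
      hK.const_mul _
    have hle := le_errorNorm (N := N) (t := t) (C := C) (memSobolevWith_doublePrimitive hg) (by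
      rw [eLpNorm_two_eq_ofReal_sqrt hg]
      simp_rw [mul_pow]
      rw [integral_const_mul, ← hS, inv_pow, hsS, inv_mul_cancel₀ hpos.ne']
      simp)
    rw [hrep (a := 0) (b := 0) (integrableOn_of_memLp_two hg) (fun x _ => by simp)] at hle
    have e : ∀ s, errorKernel N t C s * ((√S)⁻¹ * errorKernel N t C s) =
      (√S)⁻¹ * errorKernel N t C s ^ 2 := fun s => by ring
    simp_rw [e] at hle
    rw [integral_const_mul, ← hS] at hle
    refine le_trans (le_of_eq ?_) hle
    congr 1
    rw [abs_of_nonneg (by positivity), eq_inv_mul_iff_mul_eq₀ hsq.ne', ← sq, hsS]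

/-! ### Optimality of the solutions of the linear system -/

/-- Taylor's formula at 0 with integral remainder for `|x - y|^3`, whose second derivative is `6 |x
- y|`. -/
theorem integral_sub_mul_abs (y : ℝ) {x : ℝ} (hy : 0 ≤ y) :
    ∫ s in (0 : ℝ)..x, (x - s) * (6 * |s - y|) = |x - y| ^ 3 - y ^ 3 + 3 * y ^ 2 * x := by
  have hsq : ∀ s : ℝ, HasDerivAt (fun s => (s - y) * |s - y|) (2 * |s - y|) s := by
    intro s
    rcases lt_trichotomy s y with h | h | h
    · have h' := (((hasDerivAt_id s).sub_const y).pow 2).neg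
      refine (h'.congr_of_eventuallyEq ?_).congr_deriv ?_
      · filter_upwards [Iio_mem_nhds h] with z hz
        simp only [abs_of_neg (sub_neg.2 (mem_Iio.1 hz)), Pi.neg_apply, Pi.pow_apply, id]
        ring
      · simp only [abs_of_neg (sub_neg.2 h), id]
        norm_num
        ring
    -- At the kink the slope of `(z - s) * |z - s|` is `|z - s|`, which tends to 0.
    · subst h
      rw [hasDerivAt_iff_tendsto_slope]
      have : Tendsto (fun z => |z - s|) (𝓝[≠] s) (𝓝 (2 * |s - s|)) := by
        have hc : Continuous fun z => |z - s| := by fun_prop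
        simpa using (hc.tendsto s).mono_left nhdsWithin_le_nhds
      refine this.congr' ?_
      filter_upwards [self_mem_nhdsWithin] with z hz
      have : z - s ≠ 0 := sub_ne_zero.2 hz
      simp only [slope_def_field, sub_self, abs_zero, mul_zero, sub_zero]
      field_simp
    · have h' := (((hasDerivAt_id s).sub_const y).pow 2)
      refine (h'.congr_of_eventuallyEq ?_).congr_deriv ?_
      · filter_upwards [Ioi_mem_nhds h] with z hz
        simp only [abs_of_pos (sub_pos.2 (mem_Ioi.1 hz)), Pi.pow_apply, id]
        ring
      · simp only [abs_of_pos (sub_pos.2 h), id]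
        norm_num
  have hcu : ∀ s : ℝ, HasDerivAt (fun s => |s - y| ^ 3) (3 * ((s - y) * |s - y|)) s := by
    intro s
    have h := (hasDerivAt_abs_rpow (s - y) (p := 3) (by norm_num)).comp s
      ((hasDerivAt_id s).sub_const y)
    refine (h.congr_of_eventuallyEq (Eventually.of_forall fun z => ?_)).congr_deriv ?_
    · simp only [Function.comp_apply, id]
      exact_mod_cast (Real.rpow_natCast |z - y| 3).symm
    · rw [show (3 : ℝ) - 2 = 1 by norm_num, Real.rpow_one]
      ring
  -- With `F s = |s - y|^3`, the function `(x - s) * F' s + F s` has derivative `(x - s) * F'' s`.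
  rw [intervalIntegral.integral_eq_sub_of_hasDerivAt
    (f := fun s => (x - s) * (3 * ((s - y) * |s - y|)) + |s - y| ^ 3) (fun s _ => ?_)
    (Continuous.intervalIntegrable (by fun_prop) _ _)]
  · simp [abs_of_nonneg hy]
    ring
  · refine ((((hasDerivAt_id s).const_sub x).mul ((hsq s).const_mul 3)).add (hcu s)).congr_deriv ?_
    simp only [id]
    ring

theorem abs_cubed_eq_doublePrimitive {x y : ℝ} (hx : x ∈ Icc (0 : ℝ) 1) (hy : 0 ≤ y) :
    |x - y| ^ 3 = y ^ 3 + (-3 * y ^ 2) * x + doublePrimitive (fun s => 6 * |s - y|) x := by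
  have h := integral_sub_mul_abs y (x := x) hy
  have hc : Continuous fun s => max (x - s) 0 * (6 * |s - y|) := by fun_prop
  have h' : doublePrimitive (fun s => 6 * |s - y|) x =
      ∫ s in (0 : ℝ)..x, (x - s) * (6 * |s - y|) := by
    unfold doublePrimitive
    rw [← integral_Ioc_eq_integral_Ioo, ← intervalIntegral.integral_of_le zero_le_one,
      ← intervalIntegral.integral_add_adjacent_intervals (b := x) (hc.intervalIntegrable _ _)
        (hc.intervalIntegrable _ _)]
    have h1 : ∫ s in x..(1 : ℝ), max (x - s) 0 * (6 * |s - y|) = 0 := by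
      refine (intervalIntegral.integral_congr (g := fun _ => (0 : ℝ)) fun s hs => ?_).trans
        (by simp)
      rw [uIcc_of_le hx.2] at hs
      simp [max_eq_right (sub_nonpos.2 hs.1)]
    rw [h1, add_zero]
    refine intervalIntegral.integral_congr fun s hs => ?_
    rw [uIcc_of_le hx.1] at hs
    simp only [max_eq_left (sub_nonneg.2 hs.2)]
  rw [h', h]
  ring

/-- The second derivative of the spline `∑ β, d β * |x - hβ| ^ 3 / 12` when the first two moments
of `d` vanish. -/
noncomputable def ramps (N : ℕ) (d : Fin (N + 1) → ℝ) (s : ℝ) : ℝ :=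
  ∑ β : Fin (N + 1), d β * max (step N * (β : ℕ) - s) 0

theorem continuous_ramps (N : ℕ) (d : Fin (N + 1) → ℝ) : Continuous (ramps N d) := by
  unfold ramps
  fun_prop

/-- Since `2 max (a - s) 0 = |s - a| + a - s`, the two forms differ by terms that the vanishing
moments remove. -/
theorem ramps_eq {N : ℕ} {d : Fin (N + 1) → ℝ} (h₀ : ∑ γ, d γ = 0)
    (h₁ : ∑ γ, d γ * (step N * (γ : ℕ)) = 0) (s : ℝ) :
    ramps N d s = ∑ β : Fin (N + 1), d β / 12 * (6 * |s - step N * (β : ℕ)|) := by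
  have e : ∀ β : Fin (N + 1), d β * max (step N * (β : ℕ) - s) 0 =
      d β / 12 * (6 * |s - step N * (β : ℕ)|) + (1 / 2 * (d β * (step N * (β : ℕ))) -
        s / 2 * d β) := by
    intro β
    rcases le_total (step N * (β : ℕ)) s with h | h
    · rw [max_eq_right (by linarith), abs_of_nonneg (by linarith)]
      ring
    · rw [max_eq_left (by linarith), abs_of_nonpos (by linarith)]
      ring
  unfold ramps
  simp_rw [e]
  rw [Finset.sum_add_distrib, Finset.sum_sub_distrib, ← Finset.mul_sum, ← Finset.mul_sum, h₀, h₁]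
  ring

/-- By the linear system, the error on `|x - hβ|^3` is `12 (p₁ hβ + p₀)`. As `C` is exact on affine
functions, this error is the pairing of the kernel with `6 |s - hβ|`. Summing against `d` gives zero
by the moment conditions. -/
theorem integral_errorKernel_mul_ramps {N : ℕ} {t : ℝ} (hN : N ≠ 0) (ht₀ : 0 < t) (ht₁ : t < 1)
    (ht : ∀ β : ℕ, β ≤ N → t ≠ step N * β) {C : Fin (N + 1) → ℝ} {p₁ p₀ : ℝ}
    (hC : SolvesSystem N t C p₁ p₀) {d : Fin (N + 1) → ℝ} (h₀ : ∑ γ, d γ = 0)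
    (h₁ : ∑ γ, d γ * (step N * (γ : ℕ)) = 0) :
    ∫ s in Ioo (0 : ℝ) 1, errorKernel N t C s * ramps N d s = 0 := by
  have hmem : ∀ β : Fin (N + 1), step N * ((β : ℕ) : ℝ) ∈ Icc (0 : ℝ) 1 := fun β =>
    step_mul_mem_Icc hN (Nat.lt_succ_iff.1 β.2)
  have habs : ∀ y : ℝ, IntegrableOn (fun s => 6 * |s - y|) (Ioo (0 : ℝ) 1) := fun y =>
    (Continuous.integrableOn_Icc (by fun_prop)).mono_set Ioo_subset_Icc_self
  have hβ : ∀ β : Fin (N + 1), ∫ s in Ioo (0 : ℝ) 1,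
      errorKernel N t C s * (6 * |s - step N * (β : ℕ)|) =
        12 * (p₁ * (step N * (β : ℕ)) + p₀) := by
    intro β
    have hq := quadError_eq hN ht₀ ht₁ C (habs (step N * (β : ℕ)))
      (fun x hx => abs_cubed_eq_doublePrimitive hx (hmem β).1)
    rw [hC.eq_g₀, hC.eq_g₁, sub_self, sub_self, mul_zero, mul_zero, zero_add, zero_add] at hq
    rw [← hq, quadError, (hasSingularIntegral_abs_cubed (hmem β).1 (hmem β).2 ht₀ ht₁
      (ht β (Nat.lt_succ_iff.1 β.2))).singularIntegral_eq, ← hC.eq_f β, u]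
    have e : ∑ γ : Fin (N + 1), C γ * |step N * (γ : ℕ) - step N * (β : ℕ)| ^ 3 =
        12 * ∑ γ : Fin (N + 1), C γ * (|step N * (β : ℕ) - step N * (γ : ℕ)| ^ 3 / 12) := by
      rw [Finset.mul_sum]
      refine Finset.sum_congr rfl fun γ _ => ?_
      rw [abs_sub_comm]
      ring
    rw [e]
    ring
  have hint : ∀ β : Fin (N + 1), Integrable (fun s =>
      d β / 12 * (errorKernel N t C s * (6 * |s - step N * (β : ℕ)|)))
      (volume.restrict (Ioo (0 : ℝ) 1)) := by
    intro β
    obtain ⟨M, hM⟩ := exists_abs_errorKernel_le hN ht₁ C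
    refine Integrable.const_mul (Integrable.bdd_mul (c := M) (habs _)
      (stronglyMeasurable_errorKernel N t C).aestronglyMeasurable ?_) _
    filter_upwards [ae_restrict_mem measurableSet_Ioo] with s hs
    exact hM s hs
  have e : ∀ s, errorKernel N t C s * ramps N d s = ∑ β : Fin (N + 1),
      d β / 12 * (errorKernel N t C s * (6 * |s - step N * (β : ℕ)|)) := by
    intro s
    rw [ramps_eq h₀ h₁, Finset.mul_sum]
    exact Finset.sum_congr rfl fun β _ => by ring
  simp_rw [e]
  rw [integral_finsetSum _ fun β _ => hint β]
  simp_rw [integral_const_mul, hβ]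
  have e' : ∀ β : Fin (N + 1), d β / 12 * (12 * (p₁ * (step N * (β : ℕ)) + p₀)) =
      p₁ * (d β * (step N * (β : ℕ))) + p₀ * d β := fun β => by ring
  simp_rw [e']
  rw [Finset.sum_add_distrib, ← Finset.mul_sum, ← Finset.mul_sum, h₀, h₁]
  ring

/-- By continuity the ramps vanish identically on `[0,1]`, and the weights can be read off from the
last node downwards. -/
theorem eq_zero_of_integral_ramps_sq_eq_zero {N : ℕ} (hN : N ≠ 0) {d : Fin (N + 1) → ℝ}
    (h₀ : ∑ γ, d γ = 0) (h : ∫ s in Ioo (0 : ℝ) 1, ramps N d s ^ 2 = 0) : d = 0 := by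
  have hc := continuous_ramps N d
  have hzero : EqOn (ramps N d) (fun _ => 0) (Icc 0 1) := by
    refine Measure.eqOn_Icc_of_ae_eq volume (zero_ne_one' ℝ) ?_ hc.continuousOn continuousOn_const
    rw [← restrict_Ioo_eq_restrict_Icc]
    have := (integral_eq_zero_iff_of_nonneg (fun s => sq_nonneg (ramps N d s))
      ((Continuous.integrableOn_Icc (hc.pow 2)).mono_set Ioo_subset_Icc_self)).1 h
    filter_upwards [this] with s hs
    exact pow_eq_zero_iff (two_ne_zero) |>.1 hs
  have hstep : 0 < step N := by
    have : (0 : ℝ) < N := by positivity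
    rw [step]
    positivity
  have hpos : ∀ k : ℕ, ∀ β : Fin (N + 1), N - (β : ℕ) = k → (β : ℕ) ≠ 0 → d β = 0 := by
    intro k
    induction k using Nat.strong_induction_on with
    | _ k ih =>
      intro β hβ hβ0
      have hβN : (β : ℕ) ≤ N := Nat.lt_succ_iff.1 β.2
      -- Evaluate at `s = h (β - 1)`: ramps of nodes before `β` vanish there, those after `β` have
      -- zero weight by induction, and `β` itself contributes `d β * h`.
      have hz := hzero (step_mul_mem_Icc hN ((Nat.sub_le (β : ℕ) 1).trans hβN))
      rw [Nat.cast_sub (Nat.one_le_iff_ne_zero.2 hβ0), Nat.cast_one, ramps,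
        Finset.sum_eq_single β] at hz
      · rw [max_eq_left (by nlinarith)] at hz
        refine (mul_eq_zero.1 hz).resolve_right ?_
        have : step N * ((β : ℕ) : ℝ) - step N * (((β : ℕ) : ℝ) - 1) = step N := by ring
        rw [this]
        exact hstep.ne'
      · intro γ _ hγ
        rcases lt_or_gt_of_ne (Fin.val_ne_of_ne hγ) with hlt | hgt
        · have hle : ((γ : ℕ) : ℝ) ≤ ((β : ℕ) : ℝ) - 1 := by
            have : ((γ : ℕ) : ℝ) + 1 ≤ ((β : ℕ) : ℝ) := by exact_mod_cast hlt
            linarith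
          rw [max_eq_right, mul_zero]
          exact sub_nonpos.2 (mul_le_mul_of_nonneg_left hle hstep.le)
        · have hγN : (γ : ℕ) ≤ N := Nat.lt_succ_iff.1 γ.2
          rw [ih (N - γ) (by omega) γ rfl (by omega), zero_mul]
      · exact fun h => absurd (Finset.mem_univ _) h
  have hsucc : ∀ i : Fin N, d i.succ = 0 := fun i => hpos _ i.succ rfl (by simp)
  -- The ramp of node 0 is zero on `[0,1]`, so `d 0` is only seen by the moment of order 0.
  rw [Fin.sum_univ_succ] at h₀
  simp only [hsucc, Finset.sum_const_zero, add_zero] at h₀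
  funext β
  exact Fin.cases h₀ hsucc β

theorem integral_errorKernel_sq {N : ℕ} {t : ℝ} (hN : N ≠ 0) (ht₀ : 0 < t) (ht₁ : t < 1)
    (ht : ∀ β : ℕ, β ≤ N → t ≠ step N * β) {C : Fin (N + 1) → ℝ} {p₁ p₀ : ℝ}
    (hC : SolvesSystem N t C p₁ p₀) {C' : Fin (N + 1) → ℝ} (h₀ : ∑ γ, C' γ = g₀ t)
    (h₁ : ∑ γ, C' γ * (step N * (γ : ℕ)) = g₁ t) :
    ∫ s in Ioo (0 : ℝ) 1, errorKernel N t C' s ^ 2 =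
      (∫ s in Ioo (0 : ℝ) 1, errorKernel N t C s ^ 2) +
        ∫ s in Ioo (0 : ℝ) 1, ramps N (C' - C) s ^ 2 := by
  have horth := integral_errorKernel_mul_ramps hN ht₀ ht₁ ht hC (d := C' - C)
    (by simp [Finset.sum_sub_distrib, h₀, hC.eq_g₀])
    (by simp [sub_mul, Finset.sum_sub_distrib, h₁, hC.eq_g₁])
  have hsub : ∀ s, errorKernel N t C' s = errorKernel N t C s - ramps N (C' - C) s := by
    intro s
    simp [errorKernel, ramps, sub_mul, Finset.sum_sub_distrib]
  have hK := memLp_errorKernel hN ht₁ C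
  have hR : MemLp (ramps N (C' - C)) 2 (volume.restrict (Ioo (0 : ℝ) 1)) := by
    have h2 := (memLp_errorKernel hN ht₁ C).sub (memLp_errorKernel hN ht₁ C')
    refine h2.ae_eq (Eventually.of_forall fun s => ?_)
    rw [Pi.sub_apply, hsub]
    ring
  have hKR : Integrable (fun s => errorKernel N t C s * ramps N (C' - C) s)
      (volume.restrict (Ioo (0 : ℝ) 1)) := hK.integrable_mul hR
  have e : ∀ s, errorKernel N t C' s ^ 2 = errorKernel N t C s ^ 2 +
      (ramps N (C' - C) s ^ 2 - 2 * (errorKernel N t C s * ramps N (C' - C) s)) := by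
    intro s
    rw [hsub]
    ring
  simp_rw [e]
  have hsubint : Integrable (fun s => ramps N (C' - C) s ^ 2 -
      2 * (errorKernel N t C s * ramps N (C' - C) s)) (volume.restrict (Ioo (0 : ℝ) 1)) :=
    hR.integrable_sq.sub (hKR.const_mul 2)
  rw [integral_add hK.integrable_sq hsubint,
    integral_sub hR.integrable_sq (hKR.const_mul 2), integral_const_mul, horth]
  ring

/-- Only exact formulas have finite norm. Among them the squared norm exceeds that of `C` by the
squared `L²` norm of `ramps N (C' - C)`, which is zero only for `C' = C`. -/
theorem SolvesSystem.isSardOptimal_iff {N : ℕ} {t : ℝ} (hN : N ≠ 0) (ht₀ : 0 < t) (ht₁ : t < 1)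
    (ht : ∀ β : ℕ, β ≤ N → t ≠ step N * β) {C : Fin (N + 1) → ℝ} {p₁ p₀ : ℝ}
    (hC : SolvesSystem N t C p₁ p₀) (C' : Fin (N + 1) → ℝ) :
    IsSardOptimal N t C' ↔ C' = C := by
  have hnorm := errorNorm_eq hN ht₀ ht₁ hC.eq_g₀ hC.eq_g₁
  constructor
  · rintro ⟨hfin, hmin⟩
    obtain ⟨h₀, h₁⟩ := exactness_of_errorNorm_lt_top hN ht₀ ht₁ hfin
    have hle := hmin C
    rw [hnorm, errorNorm_eq hN ht₀ ht₁ h₀ h₁, ENNReal.ofReal_le_ofReal_iff (Real.sqrt_nonneg _),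
      Real.sqrt_le_sqrt_iff (integral_nonneg fun s => sq_nonneg _),
      integral_errorKernel_sq hN ht₀ ht₁ ht hC h₀ h₁] at hle
    have hz : ∫ s in Ioo (0 : ℝ) 1, ramps N (C' - C) s ^ 2 = 0 :=
      le_antisymm (by linarith) (integral_nonneg fun s => sq_nonneg _)
    exact sub_eq_zero.1 (eq_zero_of_integral_ramps_sq_eq_zero hN
      (by simp [Finset.sum_sub_distrib, h₀, hC.eq_g₀]) hz)
  · rintro rfl
    refine ⟨by rw [hnorm]; exact ENNReal.ofReal_lt_top, fun D => ?_⟩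
    rcases (le_top : errorNorm N t D ≤ ⊤).lt_or_eq with hlt | heq
    · obtain ⟨h₀, h₁⟩ := exactness_of_errorNorm_lt_top hN ht₀ ht₁ hlt
      rw [hnorm, errorNorm_eq hN ht₀ ht₁ h₀ h₁]
      refine ENNReal.ofReal_le_ofReal (Real.sqrt_le_sqrt ?_)
      rw [integral_errorKernel_sq hN ht₀ ht₁ ht hC h₀ h₁]
      exact le_add_of_nonneg_right (integral_nonneg fun s => sq_nonneg _)
    · rw [heq]
      exact le_top

theorem SolvesSystem.unique {N : ℕ} {t : ℝ} (hN : N ≠ 0) (ht₀ : 0 < t) (ht₁ : t < 1)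
    (ht : ∀ β : ℕ, β ≤ N → t ≠ step N * β) {C C' : Fin (N + 1) → ℝ} {p₁ p₀ p₁' p₀' : ℝ}
    (hC : SolvesSystem N t C p₁ p₀) (hC' : SolvesSystem N t C' p₁' p₀') :
    C' = C ∧ p₁' = p₁ ∧ p₀' = p₀ := by
  -- Both vectors are optimal, hence equal; the nodes 0 and 1 then determine `p₀` and `p₁`.
  have h : C' = C := (hC.isSardOptimal_iff hN ht₀ ht₁ ht C').1
    ((hC'.isSardOptimal_iff hN ht₀ ht₁ ht C').2 rfl)
  subst h
  have e : ∀ β : Fin (N + 1), p₁' * (step N * (β : ℕ)) + p₀' = p₁ * (step N * (β : ℕ)) + p₀ := by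
    intro β
    have := (hC'.eq_f β).trans (hC.eq_f β).symm
    unfold u at this
    linarith
  have hz : p₀' = p₀ := by simpa using e 0
  have hN' : (N : ℝ) ≠ 0 := Nat.cast_ne_zero.2 hN
  have hl := e (Fin.last N)
  rw [hz, Fin.val_last, step, one_div_mul_cancel hN'] at hl
  exact ⟨rfl, by linarith, hz⟩

/-! ### The explicit coefficients solve the system -/

theorem q_sq : q ^ 2 = -4 * q - 1 := by
  have h : √3 ^ 2 = (3 : ℝ) := Real.sq_sqrt (by norm_num)
  unfold q
  linear_combination h

theorem q_mem_Ioo : q ∈ Ioo (-(1 / 2) : ℝ) 0 := by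
  have h1 : (3 / 2 : ℝ) < √3 := Real.lt_sqrt_of_sq_lt (by norm_num)
  have h2 : √3 < 2 := (Real.sqrt_lt' (by norm_num)).2 (by norm_num)
  unfold q
  exact ⟨by linarith, by linarith⟩

theorem step_pos {N : ℕ} (hN : N ≠ 0) : 0 < step N := by
  have : (0 : ℝ) < N := by positivity
  rw [step]
  positivity

theorem step_mul_self {N : ℕ} (hN : N ≠ 0) : step N * N = 1 :=
  one_div_mul_cancel (Nat.cast_ne_zero.2 hN)

/-- It equals `h^2 (2 q + 1)^2 (q^(2N) - 1)`, and `-1/2 < q < 0`. -/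
theorem Δ_ne_zero {N : ℕ} (hN : N ≠ 0) : Δ N ≠ 0 := by
  have hq := q_mem_Ioo
  have h1 : Δ N = (step N * (2 * q + 1)) ^ 2 * ((q ^ N) ^ 2 - 1) := by
    unfold Δ B₂ A₂
    ring
  have h2 : 0 < 2 * q + 1 := by linarith [hq.1]
  have h3 : |q ^ N| < 1 := by
    rw [abs_pow]
    exact pow_lt_one₀ (abs_nonneg _) (abs_lt.2 ⟨by linarith [hq.1], by linarith [hq.2]⟩) hN
  have h4 : (q ^ N) ^ 2 < 1 := (sq_lt_one_iff_abs_lt_one _).2 h3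
  rw [h1]
  exact mul_ne_zero (pow_ne_zero _ (mul_pos (step_pos hN) h2).ne') (by linarith)

/-- Cramer's rule for a 2×2 system with determinant `Δ N`. This row serves the fourth differences at
the grid indices -1 and 0, the companion row those at `N` and `N + 1`. -/
theorem a₁_relation_left {N : ℕ} (hN : N ≠ 0) (t : ℝ) :
    -A₂ N * a₁neg N t + B₂ N * a₁pos N t = R₁ N t := by
  have h := Δ_ne_zero hN
  unfold a₁neg a₁pos Δ₁ Δ₂
  rw [mul_div_assoc', mul_div_assoc', ← add_div, div_eq_iff h, Δ]
  ring

theorem a₁_relation_right {N : ℕ} (hN : N ≠ 0) (t : ℝ) :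
    -B₂ N * a₁neg N t + A₂ N * a₁pos N t = R₂ N t := by
  have h := Δ_ne_zero hN
  unfold a₁neg a₁pos Δ₁ Δ₂
  rw [mul_div_assoc', mul_div_assoc', ← add_div, div_eq_iff h, Δ]
  ring

/-! ### Continuation of the data to the whole grid -/

/-- The cubic continuing `f` to the left of `0`. -/
noncomputable def leftCubic (N : ℕ) (t y : ℝ) : ℝ :=
  -(1 / 12) * y ^ 3 * g₀ t + (1 / 4) * y ^ 2 * g₁ t + a₁neg N t * y + a₀neg t

/-- The cubic continuing `f` to the right of `1`. -/
noncomputable def rightCubic (N : ℕ) (t y : ℝ) : ℝ :=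
  (1 / 12) * y ^ 3 * g₀ t - (1 / 4) * y ^ 2 * g₁ t + a₁pos N t * y + a₀pos N t

/-- The values of `u` at all grid points. -/
noncomputable def gridValue (N : ℕ) (t : ℝ) (k : ℤ) : ℝ :=
  if k < 0 then leftCubic N t (step N * k)
  else if k ≤ N then f (step N * k) t
  else rightCubic N t (step N * k)

theorem gridValue_of_nonpos {N : ℕ} {t : ℝ} {k : ℤ} (hk : k ≤ 0) :
    gridValue N t k = leftCubic N t (step N * k) := by
  rcases hk.lt_or_eq with h | rfl
  · simp [gridValue, h]
  · simp [gridValue, leftCubic, a₀neg]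

theorem gridValue_of_mem {N : ℕ} {t : ℝ} {k : ℤ} (hk : 0 ≤ k) (hk' : k ≤ N) :
    gridValue N t k = f (step N * k) t := by
  simp [gridValue, not_lt.2 hk, hk']

theorem gridValue_natCast {N : ℕ} {t : ℝ} {k : ℕ} (hk : k ≤ N) :
    gridValue N t k = f (step N * k) t := by
  simpa using gridValue_of_mem (N := N) (t := t) (k := k) (by simp) (by exact_mod_cast hk)

/-- At `k = N` the two descriptions agree because `a₀pos` is chosen so that the right cubic takes
the value `f 1 t` at 1. -/
theorem gridValue_of_ge {N : ℕ} (hN : N ≠ 0) {t : ℝ} {k : ℤ} (hk : (N : ℤ) ≤ k) :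
    gridValue N t k = rightCubic N t (step N * k) := by
  rcases hk.lt_or_eq with h | rfl
  · simp [gridValue, not_le.2 h, not_lt.2 ((Int.natCast_nonneg N).trans hk)]
  · rw [gridValue_natCast le_rfl, Int.cast_natCast, step_mul_self hN, rightCubic, a₀pos, a₁pos]
    ring

/-! ### Geometric sums and the uniform form of the coefficients -/

/-- The causal convolution of `f` with the powers of `q`. -/
noncomputable def leftSum (N : ℕ) (t : ℝ) (k : ℕ) : ℝ :=
  ∑ γ ∈ Finset.range (k + 1), q ^ (k - γ) * f (step N * γ) t

/-- The anticausal convolution of `f` with the powers of `q`. -/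
noncomputable def rightSum (N : ℕ) (t : ℝ) (k : ℕ) : ℝ :=
  ∑ γ ∈ Finset.Icc k N, q ^ (γ - k) * f (step N * γ) t

theorem leftSum_zero (N : ℕ) (t : ℝ) : leftSum N t 0 = f 0 t := by
  simp [leftSum]

theorem sum_range_pow_succ {N : ℕ} {t : ℝ} (k : ℕ) :
    ∑ γ ∈ Finset.range (k + 1), q ^ (k + 1 - γ) * f (step N * γ) t = q * leftSum N t k := by
  rw [leftSum, Finset.mul_sum]
  refine Finset.sum_congr rfl fun γ hγ => ?_
  rw [Nat.succ_sub (Nat.lt_succ_iff.1 (Finset.mem_range.1 hγ)), pow_succ]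
  ring

theorem leftSum_succ (N : ℕ) (t : ℝ) (k : ℕ) :
    leftSum N t (k + 1) = q * leftSum N t k + f (step N * (k + 1 : ℕ)) t := by
  rw [leftSum, Finset.sum_range_succ, sum_range_pow_succ]
  simp

theorem rightSum_last (N : ℕ) (t : ℝ) : rightSum N t N = f (step N * N) t := by
  simp [rightSum]

theorem sum_Icc_pow_succ {N : ℕ} {t : ℝ} (k : ℕ) :
    ∑ γ ∈ Finset.Icc (k + 1) N, q ^ (γ - k) * f (step N * γ) t = q * rightSum N t (k + 1) := by
  rw [rightSum, Finset.mul_sum]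
  refine Finset.sum_congr rfl fun γ hγ => ?_
  rw [show γ - k = γ - (k + 1) + 1 by have := (Finset.mem_Icc.1 hγ).1; omega, pow_succ]
  ring

theorem rightSum_eq {N k : ℕ} (hk : k ≤ N) (t : ℝ) :
    rightSum N t k = q * rightSum N t (k + 1) + f (step N * k) t := by
  rw [rightSum, ← Finset.add_sum_Ioc_eq_sum_Icc hk, ← Finset.Icc_add_one_left_eq_Ioc,
    sum_Icc_pow_succ]
  simp [add_comm]

/-- The amplitude of the mode decaying away from `0`. -/
noncomputable def leftAmplitude (N : ℕ) (t : ℝ) : ℝ :=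
  a₁neg N t * step N * (q + 2) - 3 * f 0 t * (q + 1) - g₁ t / 4 * step N ^ 2

/-- The amplitude of the mode decaying away from `1`. -/
noncomputable def rightAmplitude (N : ℕ) (t : ℝ) : ℝ :=
  g₁ t / 4 * (2 * step N * (q + 2) + step N ^ 2) -
    (3 * f 1 t * (q + 1) + g₀ t / 4 * (step N * (q + 2) + step N ^ 2) +
      a₁pos N t * step N * (q + 2))

/-- `coeff` up to the factor `6 / h ^ 3`, in a form uniform in the node. -/
noncomputable def scaledCoeff (N : ℕ) (t : ℝ) (k : ℕ) : ℝ :=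
  gridValue N t ((k : ℤ) - 1) - 8 * gridValue N t k + gridValue N t ((k : ℤ) + 1) +
    6 * (q + 2) * (leftSum N t k + rightSum N t k - f (step N * k) t) +
    leftAmplitude N t * q ^ k + rightAmplitude N t * q ^ (N - k)

theorem coeffFirst_eq {N : ℕ} (hN : 2 ≤ N) (t : ℝ) :
    coeffFirst N t = 6 / step N ^ 3 * scaledCoeff N t 0 := by
  have hs : ∑ γ ∈ Finset.Icc 2 N, q ^ γ * f (step N * γ) t = q ^ 2 * rightSum N t 2 := by
    rw [rightSum, Finset.mul_sum]
    refine Finset.sum_congr rfl fun γ hγ => ?_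
    have e : γ = 2 + (γ - 2) := by have := (Finset.mem_Icc.1 hγ).1; omega
    nth_rewrite 1 [e]
    rw [pow_add]
    ring
  have h1 : gridValue N t ((0 : ℕ) + 1) = f (step N) t := by
    simpa using gridValue_natCast (N := N) (t := t) (k := 1) (by omega)
  have h0 : gridValue N t (0 : ℕ) = f 0 t := by
    simpa using gridValue_natCast (N := N) (t := t) (k := 0) (by omega)
  have hr := rightSum_eq (N := N) (k := 0) (by omega) t
  rw [rightSum_eq (N := N) (k := 0 + 1) (by omega) t] at hr
  simp only [zero_add, Nat.cast_zero, Nat.cast_one, mul_zero, mul_one] at hr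
  rw [coeffFirst, scaledCoeff, hs, h1, h0, gridValue_of_nonpos (by simp), leftSum_zero,
    leftCubic, a₀neg, hr, leftAmplitude, rightAmplitude]
  push_cast
  simp only [mul_zero, Nat.sub_zero]
  congr 1
  -- The weight of `f h` is `1 + 6 (q + 2) q`, which reduces to `-(12 q + 5)`.
  linear_combination (-6 * f (step N) t) * q_sq

theorem coeffLast_eq {N : ℕ} (hN : 2 ≤ N) (t : ℝ) :
    coeffLast N t = 6 / step N ^ 3 * scaledCoeff N t N := by
  obtain ⟨M, rfl⟩ : ∃ M, N = M + 2 := ⟨N - 2, by omega⟩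
  have hh := step_mul_self (N := M + 2) (by omega)
  set h := step (M + 2) with hh'
  have hs : ∑ γ ∈ Finset.range (M + 2 - 1), q ^ (M + 2 - γ) * f (h * γ) t =
      q ^ 2 * leftSum (M + 2) t M := by
    rw [leftSum, Finset.mul_sum]
    refine Finset.sum_congr rfl fun γ hγ => ?_
    have e : M + 2 - γ = 2 + (M - γ) := by have := Finset.mem_range.1 hγ; omega
    rw [e, pow_add]
    ring
  have e1 : h * ((M + 1 : ℕ) : ℝ) = 1 - h := by
    push_cast at hh ⊢
    linear_combination hh
  have h1 : gridValue (M + 2) t (((M + 2 : ℕ) : ℤ) - 1) = f (1 - h) t := by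
    have := gridValue_natCast (N := M + 2) (t := t) (k := M + 1) (by omega)
    rw [← hh', e1] at this
    rw [← this]
    congr 1
    push_cast
    ring
  have h0 : gridValue (M + 2) t ((M + 2 : ℕ) : ℤ) = f 1 t := by
    rw [gridValue_natCast le_rfl, ← hh', hh]
  have hl := leftSum_succ (M + 2) t (M + 1)
  rw [leftSum_succ (M + 2) t M, ← hh', e1, show M + 1 + 1 = M + 2 from rfl, hh] at hl
  have hr := rightSum_last (M + 2) t
  rw [← hh', hh] at hr
  have e2 : h * ((((M + 2 : ℕ) : ℤ) + 1 : ℤ) : ℝ) = 1 + h := by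
    push_cast at hh ⊢
    linear_combination hh
  rw [coeffLast, scaledCoeff, ← hh']
  rw [hs, h1, h0, gridValue_of_ge (by omega) (by simp), ← hh', e2, hr, hl, hh, rightCubic, a₀pos,
    leftAmplitude, rightAmplitude, ← hh', ← a₁pos]
  simp only [Nat.sub_self, pow_zero]
  congr 1
  linear_combination (-6 * f (1 - h) t) * q_sq

theorem coeffMiddle_eq {N β : ℕ} (h₀ : 0 < β) (h₁ : β < N) (t : ℝ) :
    coeffMiddle N t β = 6 / step N ^ 3 * scaledCoeff N t β := by
  obtain ⟨b, rfl⟩ : ∃ b, β = b + 1 := ⟨β - 1, by omega⟩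
  set h := step N with hh'
  have hs₁ : ∑ γ ∈ Finset.range (b + 1 - 1), q ^ (b + 1 - γ) * f (h * γ) t =
      q * leftSum N t b - q * f (h * b) t := by
    rw [← sum_range_pow_succ, Finset.sum_range_succ, ← hh']
    simp
  have hs₂ : ∑ γ ∈ Finset.Icc (b + 1 + 2) N, q ^ (γ - (b + 1)) * f (h * γ) t =
      q * rightSum N t (b + 1 + 1) - q * f (h * (b + 1 + 1 : ℕ)) t := by
    have e := Finset.add_sum_Ioc_eq_sum_Icc (a := b + 1 + 1) (b := N)
      (f := fun γ : ℕ => q ^ (γ - (b + 1)) * f (h * γ) t) (by omega)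
    rw [← Finset.Icc_add_one_left_eq_Ioc] at e
    rw [← sum_Icc_pow_succ, ← hh', ← e, Nat.add_sub_cancel_left, pow_one]
    exact (add_sub_cancel_left _ _).symm
  have e1 : gridValue N t (((b + 1 : ℕ) : ℤ) - 1) = f (h * b) t := by
    rw [hh', ← gridValue_natCast (by omega)]
    congr 1
    push_cast
    ring
  have e2 : gridValue N t (((b + 1 : ℕ) : ℤ) + 1) = f (h * (b + 1 + 1 : ℕ)) t := by
    rw [hh', ← gridValue_natCast (by omega)]
    congr 1
  have e3 : h * (((b + 1 : ℕ) : ℝ) - 1) = h * b := by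
    push_cast
    ring
  have e4 : h * (((b + 1 : ℕ) : ℝ) + 1) = h * (b + 1 + 1 : ℕ) := by
    push_cast
    ring
  rw [coeffMiddle, scaledCoeff, ← hh']
  rw [hs₁, hs₂, e1, e2, e3, e4, gridValue_natCast h₁.le, leftSum_succ, rightSum_eq h₁.le, ← hh',
    leftAmplitude, rightAmplitude, ← hh']
  congr 1
  linear_combination (-6 * f (h * b) t - 6 * f (h * (b + 1 + 1 : ℕ)) t) * q_sq

theorem coeff_eq {N : ℕ} (hN : 2 ≤ N) (t : ℝ) (β : Fin (N + 1)) :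
    coeff N t β = 6 / step N ^ 3 * scaledCoeff N t β := by
  unfold coeff
  split_ifs with h0 h1
  · rw [coeffFirst_eq hN, h0]
  · rw [coeffLast_eq hN, h1]
  · exact coeffMiddle_eq (Nat.pos_of_ne_zero h0)
      (lt_of_le_of_ne (Nat.lt_succ_iff.1 β.2) h1) t

/-! ### The (1, 4, 1) equation for the continued data -/

/-- The central fourth difference. -/
def fourthDiff (v : ℤ → ℝ) (k : ℤ) : ℝ :=
  v (k - 2) - 4 * v (k - 1) + 6 * v k - 4 * v (k + 1) + v (k + 2)

theorem R₁_eq (N : ℕ) (t : ℝ) :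
    R₁ N t = -(6 * (q + 2) * (q ^ 2 * rightSum N t 1) - (12 * q + 5) * f 0 t)
      - (1 / 12) * g₀ t * (B₁ N + 3 * B₂ N + 3 * B₃ N)
      + (1 / 4) * g₁ t * (B₁ N + 2 * B₂ N + B₃ N - A₃ N)
      - A₁ * f 0 t - B₁ N * (f 1 t - (1 / 12) * g₀ t + (1 / 4) * g₁ t) := by
  have h : ∑ γ ∈ Finset.Icc 1 N, q ^ (γ + 1) * f (step N * γ) t = q ^ 2 * rightSum N t 1 := by
    rw [rightSum, Finset.mul_sum]
    refine Finset.sum_congr rfl fun γ hγ => ?_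
    rw [show γ + 1 = 2 + (γ - 1) by have := (Finset.mem_Icc.1 hγ).1; omega, pow_add]
    ring
  rw [R₁, F₁, h]

theorem R₂_eq {M : ℕ} (t : ℝ) :
    R₂ (M + 1) t = -(6 * (q + 2) * (q ^ 2 * leftSum (M + 1) t M) - (12 * q + 5) * f 1 t)
      - (1 / 12) * g₀ t * (A₁ + 3 * A₂ (M + 1) + 3 * A₃ (M + 1))
      + (1 / 4) * g₁ t * (A₁ + 2 * A₂ (M + 1) + A₃ (M + 1) - B₃ (M + 1))
      - B₁ (M + 1) * f 0 t - A₁ * (f 1 t - (1 / 12) * g₀ t + (1 / 4) * g₁ t) := by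
  have h : ∑ γ ∈ Finset.Icc 0 (M + 1 - 1), q ^ (M + 1 + 1 - γ) * f (step (M + 1) * γ) t =
      q ^ 2 * leftSum (M + 1) t M := by
    rw [leftSum, Finset.mul_sum, Nat.add_sub_cancel, ← Nat.range_succ_eq_Icc_zero]
    refine Finset.sum_congr rfl fun γ hγ => ?_
    rw [show M + 1 + 1 - γ = 2 + (M - γ) by have := Finset.mem_range.1 hγ; omega, pow_add]
    ring
  rw [R₂, F₂, h]

theorem fourthDiff_gridValue_neg_one {N : ℕ} (hN : 2 ≤ N) (t : ℝ) :
    fourthDiff (gridValue N t) (-1) = scaledCoeff N t 0 := by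
  have h1 : gridValue N t 1 = f (step N) t := by
    simpa using gridValue_natCast (N := N) (t := t) (k := 1) (by omega)
  have h0 : gridValue N t 0 = f 0 t := by
    simpa using gridValue_natCast (N := N) (t := t) (k := 0) (by omega)
  have hr := rightSum_eq (N := N) (k := 0) (by omega) t
  simp only [zero_add, Nat.cast_zero, mul_zero] at hr
  have hE := a₁_relation_left (N := N) (by omega) t
  rw [R₁_eq, A₁, A₂, A₃, B₁, B₂, B₃, pow_succ q N] at hE
  rw [scaledCoeff, fourthDiff]
  norm_num
  rw [h0, h1, leftSum_zero, hr, gridValue_of_nonpos (k := -3) (by norm_num),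
    gridValue_of_nonpos (k := -2) (by norm_num), gridValue_of_nonpos (k := -1) (by norm_num),
    leftCubic, leftCubic, leftCubic, a₀neg, leftAmplitude, rightAmplitude]
  push_cast
  -- What remains is a polynomial identity modulo `q^2 + 4 q + 1` and the relation between `a₁neg`
  -- and `a₁pos`; all transcendental quantities are replaced by free variables.
  have hq := q_sq
  generalize q ^ N = Z at *
  generalize rightSum N t 1 = S at *
  generalize q = r at *
  generalize step N = h at *
  generalize a₁neg N t = x at *
  generalize a₁pos N t = y at *
  generalize f 0 t = a at *
  generalize f 1 t = b at *
  generalize f h t = c at *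
  generalize g₀ t = d at *
  generalize g₁ t = e at *
  clear hr h0 h1 hN
  grind

theorem fourthDiff_gridValue_zero {N : ℕ} (hN : 2 ≤ N) (t : ℝ) :
    fourthDiff (gridValue N t) 0 = 4 * scaledCoeff N t 0 + scaledCoeff N t 1 := by
  obtain ⟨M, rfl⟩ : ∃ M, N = M + 1 := ⟨N - 1, by omega⟩
  have h1 : gridValue (M + 1) t 1 = f (step (M + 1)) t := by
    simpa using gridValue_natCast (N := M + 1) (t := t) (k := 1) (by omega)
  have h0 : gridValue (M + 1) t 0 = f 0 t := by
    simpa using gridValue_natCast (N := M + 1) (t := t) (k := 0) (by omega)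
  have hr := rightSum_eq (N := M + 1) (k := 0) (by omega) t
  have hl := leftSum_succ (M + 1) t 0
  simp only [zero_add, Nat.cast_zero, mul_zero, Nat.cast_one, mul_one, leftSum_zero] at hr hl
  have hE := a₁_relation_left (N := M + 1) (by omega) t
  rw [R₁_eq, A₁, A₂, A₃, B₁, B₂, B₃, pow_succ q (M + 1), pow_succ q M] at hE
  rw [scaledCoeff, scaledCoeff, fourthDiff]
  norm_num
  rw [h0, h1, leftSum_zero, hr, hl, pow_succ q M, gridValue_of_nonpos (k := -2) (by norm_num),
    gridValue_of_nonpos (k := -1) (by norm_num),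
    leftCubic, leftCubic, a₀neg, leftAmplitude, rightAmplitude]
  push_cast
  have hq := q_sq
  generalize q ^ M = Z at *
  generalize rightSum (M + 1) t 1 = S at *
  generalize gridValue (M + 1) t 2 = v at *
  generalize q = r at *
  generalize step (M + 1) = h at *
  generalize a₁neg (M + 1) t = x at *
  generalize a₁pos (M + 1) t = y at *
  generalize f 0 t = a at *
  generalize f 1 t = b at *
  generalize f h t = c at *
  generalize g₀ t = d at *
  generalize g₁ t = e at *
  clear hr hl h0 h1 hN
  grind

/-- The stencil (1, 4, 1) kills both modes `q^k` and `q^(N - k)`. Applied to the kernel `q^|k|` it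
leaves `2 (q + 2)` at the origin, and `12 (q + 2)^2 = 36`. Convolving (1, 4, 1) with (1, -8, 1)
gives (1, -4, -30, -4, 1); adding 36 in the centre gives the fourth difference. -/
theorem fourthDiff_gridValue_interior {N k : ℕ} (hk : k + 2 ≤ N) (t : ℝ) :
    fourthDiff (gridValue N t) ((k : ℤ) + 1) =
      scaledCoeff N t k + 4 * scaledCoeff N t (k + 1) + scaledCoeff N t (k + 2) := by
  have e0 := gridValue_natCast (N := N) (t := t) (k := k) (by omega)
  have e1 := gridValue_natCast (N := N) (t := t) (k := k + 1) (by omega)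
  have e2 := gridValue_natCast (N := N) (t := t) (k := k + 2) hk
  have z : q ^ (N - (k + 1)) = q ^ (N - (k + 2)) * q := by
    rw [← pow_succ]
    congr 1
    omega
  have z' : q ^ (N - k) = q ^ (N - (k + 2)) * q ^ 2 := by
    rw [← pow_add]
    congr 1
    omega
  rw [scaledCoeff, scaledCoeff, scaledCoeff, fourthDiff, ← e0, ← e1, ← e2,
    leftSum_succ N t (k + 1), leftSum_succ, rightSum_eq (N := N) (k := k) (by omega),
    rightSum_eq (N := N) (k := k + 1) (by omega), ← e0, ← e1, show k + 1 + 1 = k + 2 from rfl, ← e2,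
    z, z', pow_add q k 2, pow_succ q k]
  push_cast
  rw [show (k : ℤ) + 1 - 2 = k - 1 by ring, show (k : ℤ) + 1 - 1 = k by ring,
    show (k : ℤ) + 1 + 1 = k + 2 by ring, show (k : ℤ) + 1 + 2 = k + 3 by ring,
    show (k : ℤ) + 2 - 1 = k + 1 by ring, show (k : ℤ) + 2 + 1 = k + 3 by ring]
  have hq := q_sq
  clear e0 e1 e2 z z' hk
  generalize q ^ (N - (k + 2)) = Z at *
  generalize q ^ k = Y at *
  generalize gridValue N t (k - 1) = v₁ at *
  generalize gridValue N t k = v₂ at *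
  generalize gridValue N t (k + 1) = v₃ at *
  generalize gridValue N t (k + 2) = v₄ at *
  generalize gridValue N t (k + 3) = v₅ at *
  generalize leftSum N t k = S at *
  generalize rightSum N t (k + 2) = T at *
  generalize leftAmplitude N t = K at *
  generalize rightAmplitude N t = K' at *
  generalize q = r at *
  grind

theorem fourthDiff_gridValue_last {M : ℕ} (t : ℝ) :
    fourthDiff (gridValue (M + 2) t) ((M : ℤ) + 2) =
      scaledCoeff (M + 2) t (M + 1) + 4 * scaledCoeff (M + 2) t (M + 2) := by
  have hh := step_mul_self (N := M + 2) (by omega)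
  have e1 := gridValue_natCast (N := M + 2) (t := t) (k := M + 1) (by omega)
  have e2 := gridValue_natCast (N := M + 2) (t := t) (k := M + 2) (by omega)
  rw [hh] at e2
  have hl := leftSum_succ (M + 2) t (M + 1)
  have hr := rightSum_eq (N := M + 2) (k := M + 1) (by omega) t
  rw [rightSum_last, ← e1, show M + 1 + 1 = M + 2 from rfl, hh] at hr
  rw [show M + 1 + 1 = M + 2 from rfl, hh] at hl
  have hE := a₁_relation_right (N := M + 2) (by omega) t
  rw [R₂_eq, A₁, A₂, A₃, B₁, B₂, B₃, show M + 1 + 1 = M + 2 from rfl, pow_succ q (M + 2),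
    pow_succ q (M + 1)] at hE
  rw [scaledCoeff, scaledCoeff, fourthDiff, hl, hr, ← e1, rightSum_last, hh]
  push_cast at *
  rw [show (M : ℤ) + 2 - 2 = M by ring, show (M : ℤ) + 2 - 1 = M + 1 by ring,
    show (M : ℤ) + 1 - 1 = M by ring, show (M : ℤ) + 1 + 1 = M + 2 by ring, e2,
    gridValue_of_ge (k := M + 2 + 1) (by omega) (by push_cast; omega),
    gridValue_of_ge (k := M + 2 + 2) (by omega) (by push_cast; omega),
    show M + 1 - M = 1 by omega, Nat.sub_self, pow_succ q (M + 1),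
    rightCubic, rightCubic, a₀pos, leftAmplitude, rightAmplitude, ← a₁pos]
  push_cast
  rw [show step (M + 2) * ((M : ℝ) + 2 + 1) = 1 + step (M + 2) by linear_combination hh,
    show step (M + 2) * ((M : ℝ) + 2 + 2) = 1 + 2 * step (M + 2) by linear_combination hh]
  have hq := q_sq
  generalize q ^ (M + 1) = Z at *
  generalize leftSum (M + 2) t (M + 1) = S at *
  generalize gridValue (M + 2) t M = v at *
  generalize gridValue (M + 2) t (M + 1) = c at *
  generalize q = r at *
  generalize a₁neg (M + 2) t = x at *
  generalize a₁pos (M + 2) t = y at *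
  generalize f 0 t = a at *
  generalize f 1 t = b at *
  generalize step (M + 2) = h at *
  generalize g₀ t = d at *
  generalize g₁ t = e at *
  clear hr hl e1 e2 hh
  grind

theorem fourthDiff_gridValue_last_add_one {M : ℕ} (t : ℝ) :
    fourthDiff (gridValue (M + 2) t) ((M : ℤ) + 3) = scaledCoeff (M + 2) t (M + 2) := by
  have hh := step_mul_self (N := M + 2) (by omega)
  have e2 := gridValue_natCast (N := M + 2) (t := t) (k := M + 2) (by omega)
  rw [hh] at e2
  have hl := leftSum_succ (M + 2) t (M + 1)
  rw [show M + 1 + 1 = M + 2 from rfl, hh] at hl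
  have hE := a₁_relation_right (N := M + 2) (by omega) t
  rw [R₂_eq, A₁, A₂, A₃, B₁, B₂, B₃, show M + 1 + 1 = M + 2 from rfl, pow_succ q (M + 2)] at hE
  rw [scaledCoeff, fourthDiff, hl, rightSum_last, hh]
  push_cast at *
  rw [show (M : ℤ) + 3 - 2 = M + 1 by ring, show (M : ℤ) + 3 - 1 = M + 2 by ring,
    show (M : ℤ) + 2 - 1 = M + 1 by ring, show (M : ℤ) + 2 + 1 = M + 3 by ring, e2,
    gridValue_of_ge (k := M + 3) (by omega) (by push_cast; omega),
    gridValue_of_ge (k := M + 3 + 1) (by omega) (by push_cast; omega),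
    gridValue_of_ge (k := M + 3 + 2) (by omega) (by push_cast; omega),
    Nat.sub_self,
    rightCubic, rightCubic, rightCubic, a₀pos, leftAmplitude, rightAmplitude, ← a₁pos]
  push_cast
  rw [show step (M + 2) * ((M : ℝ) + 3) = 1 + step (M + 2) by linear_combination hh,
    show step (M + 2) * ((M : ℝ) + 3 + 1) = 1 + 2 * step (M + 2) by linear_combination hh,
    show step (M + 2) * ((M : ℝ) + 3 + 2) = 1 + 3 * step (M + 2) by linear_combination hh]
  have hq := q_sq
  generalize q ^ (M + 2) = Z at *
  generalize leftSum (M + 2) t (M + 1) = S at *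
  generalize gridValue (M + 2) t (M + 1) = c at *
  generalize q = r at *
  generalize a₁neg (M + 2) t = x at *
  generalize a₁pos (M + 2) t = y at *
  generalize f 0 t = a at *
  generalize f 1 t = b at *
  generalize step (M + 2) = h at *
  generalize g₀ t = d at *
  generalize g₁ t = e at *
  clear hl e2 hh
  grind

/-! ### Fourth differences of the cubic spline -/

theorem fourthDiff_abs_cubed (m : ℤ) :
    fourthDiff (fun k => |(k : ℝ)| ^ 3) m =
      2 * (if m = 1 then 1 else 0) + 8 * (if m = 0 then 1 else 0) +
        2 * (if m = -1 then 1 else 0) := by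
  have hm : m ≤ -2 ∨ m = -1 ∨ m = 0 ∨ m = 1 ∨ 2 ≤ m := by omega
  unfold fourthDiff
  rcases hm with h | rfl | rfl | rfl | h
  · have h' : (m : ℝ) ≤ -2 := by exact_mod_cast h
    push_cast
    rw [if_neg (by omega), if_neg (by omega), if_neg (by omega), abs_of_nonpos (by linarith),
      abs_of_nonpos (by linarith), abs_of_nonpos (by linarith), abs_of_nonpos (by linarith),
      abs_of_nonpos (by linarith)]
    ring
  · norm_num
  · norm_num
  · norm_num
  · have h' : (2 : ℝ) ≤ m := by exact_mod_cast h
    push_cast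
    rw [if_neg (by omega), if_neg (by omega), if_neg (by omega), abs_of_nonneg (by linarith),
      abs_of_nonneg (by linarith), abs_of_nonneg (by linarith), abs_of_nonneg (by linarith),
      abs_of_nonneg (by linarith)]
    ring

/-- The coefficient vector, extended by zero to all grid points. -/
def extendedCoeff (N : ℕ) (C : Fin (N + 1) → ℝ) (k : ℤ) : ℝ :=
  ∑ γ : Fin (N + 1), C γ * (if k = ((γ : ℕ) : ℤ) then 1 else 0)

theorem extendedCoeff_natCast {N : ℕ} (C : Fin (N + 1) → ℝ) (β : Fin (N + 1)) :
    extendedCoeff N C ((β : ℕ) : ℤ) = C β := by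
  rw [extendedCoeff, Finset.sum_eq_single β]
  · simp
  · intro γ _ hγ
    have : (β : ℕ) ≠ γ := fun h => hγ (Fin.ext h.symm)
    simp [this]
  · simp

theorem extendedCoeff_of_notMem {N : ℕ} (C : Fin (N + 1) → ℝ) {k : ℤ} (hk : k < 0 ∨ (N : ℤ) < k) :
    extendedCoeff N C k = 0 := by
  refine Finset.sum_eq_zero fun γ _ => ?_
  have := γ.2
  rw [if_neg (by omega), mul_zero]

/-- The affine part drops out, and each `|y - hγ|^3 / 12` contributes `h^3 / 12` times the weights
2, 8, 2 around its node. -/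
theorem fourthDiff_u {N : ℕ} (C : Fin (N + 1) → ℝ) (p₁ p₀ : ℝ) (k : ℤ) :
    fourthDiff (fun k => u N C p₁ p₀ (step N * k)) k = step N ^ 3 / 6 *
      (extendedCoeff N C (k - 1) + 4 * extendedCoeff N C k + extendedCoeff N C (k + 1)) := by
  have hterm : ∀ (γ : Fin (N + 1)) (j : ℤ), C γ * (|step N * j - step N * (γ : ℕ)| ^ 3 / 12) =
      C γ * (step N ^ 3 / 12 * |((j - (γ : ℕ) : ℤ) : ℝ)| ^ 3) := by
    intro γ j
    have h0 : 0 ≤ step N := by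
      unfold step
      positivity
    rw [← mul_sub, abs_mul, abs_of_nonneg h0, mul_pow]
    push_cast
    ring
  have hγ : ∀ γ : Fin (N + 1), fourthDiff
      (fun j => C γ * (step N ^ 3 / 12 * |((j - (γ : ℕ) : ℤ) : ℝ)| ^ 3)) k =
      step N ^ 3 / 6 * (C γ * (if k - 1 = ((γ : ℕ) : ℤ) then 1 else 0) +
        4 * (C γ * (if k = ((γ : ℕ) : ℤ) then 1 else 0)) +
        C γ * (if k + 1 = ((γ : ℕ) : ℤ) then 1 else 0)) := by
    intro γ
    have h := fourthDiff_abs_cubed (k - (γ : ℕ))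
    have i1 : (k - ((γ : ℕ) : ℤ) = 1) ↔ (k - 1 = ((γ : ℕ) : ℤ)) := by omega
    have i2 : (k - ((γ : ℕ) : ℤ) = 0) ↔ (k = ((γ : ℕ) : ℤ)) := by omega
    have i3 : (k - ((γ : ℕ) : ℤ) = -1) ↔ (k + 1 = ((γ : ℕ) : ℤ)) := by omega
    simp only [i1, i2, i3] at h
    unfold fourthDiff at h ⊢
    beta_reduce at h ⊢
    rw [show k - 2 - ((γ : ℕ) : ℤ) = k - (γ : ℕ) - 2 by ring,
      show k - 1 - ((γ : ℕ) : ℤ) = k - (γ : ℕ) - 1 by ring,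
      show k + 2 - ((γ : ℕ) : ℤ) = k - (γ : ℕ) + 2 by ring,
      show k + 1 - ((γ : ℕ) : ℤ) = k - (γ : ℕ) + 1 by ring]
    linear_combination (C γ * step N ^ 3 / 12) * h
  unfold extendedCoeff
  rw [Finset.mul_sum, ← Finset.sum_add_distrib, ← Finset.sum_add_distrib, Finset.mul_sum,
    ← Finset.sum_congr rfl fun γ _ => hγ γ]
  unfold fourthDiff u
  simp only [hterm, Finset.sum_add_distrib, Finset.sum_sub_distrib, ← Finset.mul_sum]
  push_cast
  ring

/-! ### Identification of the spline with the continued data -/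

theorem eq_zero_of_fourthDiff_eq_zero {w : ℤ → ℝ} (hw : ∀ k, fourthDiff w k = 0)
    (h0 : ∀ k ≤ 0, w k = 0) (k : ℤ) : w k = 0 := by
  have key : ∀ n : ℕ, ∀ j : ℤ, j ≤ n → w j = 0 := by
    intro n
    induction n with
    | zero => exact fun j hj => h0 j (by simpa using hj)
    | succ n ih =>
      intro j hj
      rcases hj.lt_or_eq with hlt | rfl
      · exact ih j (by push_cast at hlt; omega)
      · have h := hw ((n : ℤ) - 1)
        unfold fourthDiff at h
        rw [ih _ (by omega), ih _ (by omega), ih _ (by omega), ih _ (by omega)] at h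
        push_cast
        rw [show (n : ℤ) - 1 + 2 = n + 1 by ring] at h
        linarith
  exact key k.toNat k (Int.self_le_toNat k)

theorem extendedCoeff_coeff {N : ℕ} (hN : 2 ≤ N) (t : ℝ) {k : ℕ} (hk : k ≤ N) :
    step N ^ 3 / 6 * extendedCoeff N (coeff N t) k = scaledCoeff N t k := by
  have h := extendedCoeff_natCast (coeff N t) ⟨k, Nat.lt_succ_iff.2 hk⟩
  have h0 := (step_pos (N := N) (by omega)).ne'
  simp only at h
  rw [h, coeff_eq hN]
  field_simp

theorem fourthDiff_gridValue {N : ℕ} (hN : 2 ≤ N) (t : ℝ) (k : ℤ) :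
    fourthDiff (gridValue N t) k = step N ^ 3 / 6 *
      (extendedCoeff N (coeff N t) (k - 1) + 4 * extendedCoeff N (coeff N t) k +
        extendedCoeff N (coeff N t) (k + 1)) := by
  set c := extendedCoeff N (coeff N t) with hc
  have hout : ∀ j : ℤ, (j < 0 ∨ (N : ℤ) < j) → c j = 0 := fun j hj =>
    extendedCoeff_of_notMem _ hj
  have hin : ∀ (j : ℤ) (i : ℕ), j = i → i ≤ N → step N ^ 3 / 6 * c j = scaledCoeff N t i := by
    rintro _ i rfl hi
    exact extendedCoeff_coeff hN t hi
  have hk : k ≤ -2 ∨ k = -1 ∨ k = 0 ∨ (1 ≤ k ∧ k + 1 ≤ N) ∨ k = N ∨ k = N + 1 ∨ (N : ℤ) + 2 ≤ k := by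
    omega
  rcases hk with h | h | h | ⟨h, h'⟩ | h | h | h
  · rw [hout _ (by omega), hout _ (by omega), hout _ (by omega)]
    unfold fourthDiff
    rw [gridValue_of_nonpos (by omega), gridValue_of_nonpos (by omega),
      gridValue_of_nonpos (by omega), gridValue_of_nonpos (by omega),
      gridValue_of_nonpos (by omega)]
    unfold leftCubic
    push_cast
    ring
  · subst h
    rw [hout _ (by omega), hout (-1) (by omega), fourthDiff_gridValue_neg_one hN,
      ← hin (-1 + 1) 0 (by simp) (by omega)]
    ring
  · subst h
    rw [hout _ (by omega), fourthDiff_gridValue_zero hN, ← hin 0 0 (by simp) (by omega),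
      ← hin (0 + 1) 1 (by simp) (by omega)]
    ring
  · obtain ⟨i, hi⟩ : ∃ i : ℕ, k = i + 1 := ⟨(k - 1).toNat, by omega⟩
    subst hi
    rw [fourthDiff_gridValue_interior (by omega),
      ← hin ((i : ℤ) + 1 - 1) i (by ring) (by omega),
      ← hin ((i : ℤ) + 1) (i + 1) (by push_cast; ring) (by omega),
      ← hin ((i : ℤ) + 1 + 1) (i + 2) (by push_cast; ring) (by omega)]
    ring
  · obtain ⟨M, rfl⟩ : ∃ M, N = M + 2 := ⟨N - 2, by omega⟩
    rw [show k = (M : ℤ) + 2 by rw [h]; push_cast; ring, fourthDiff_gridValue_last,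
      hout ((M : ℤ) + 2 + 1) (by push_cast; omega),
      ← hin ((M : ℤ) + 2 - 1) (M + 1) (by push_cast; ring) (by omega),
      ← hin ((M : ℤ) + 2) (M + 2) (by push_cast; ring) (by omega)]
    ring
  · obtain ⟨M, rfl⟩ : ∃ M, N = M + 2 := ⟨N - 2, by omega⟩
    rw [show k = (M : ℤ) + 3 by rw [h]; push_cast; ring, fourthDiff_gridValue_last_add_one,
      hout ((M : ℤ) + 3) (by push_cast; omega), hout ((M : ℤ) + 3 + 1) (by push_cast; omega),
      ← hin ((M : ℤ) + 3 - 1) (M + 2) (by push_cast; ring) (by omega)]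
    ring
  · rw [hout _ (by omega), hout _ (by omega), hout _ (by omega)]
    unfold fourthDiff
    rw [gridValue_of_ge (by omega) (by omega), gridValue_of_ge (by omega) (by omega),
      gridValue_of_ge (by omega) (by omega), gridValue_of_ge (by omega) (by omega),
      gridValue_of_ge (by omega) (by omega)]
    unfold rightCubic
    push_cast
    ring

/-- Outside `[0,1]` all differences `y - hγ` have one sign, so the spline is a single cubic whose
coefficients are moments of `C`. -/
theorem u_of_le {N : ℕ} (C : Fin (N + 1) → ℝ) (p₁ p₀ : ℝ) {y : ℝ} (hy : y ≤ 0) :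
    u N C p₁ p₀ y = -(1 / 12) * y ^ 3 * (∑ γ, C γ) +
      1 / 4 * y ^ 2 * (∑ γ, C γ * (step N * (γ : ℕ))) -
      1 / 4 * y * (∑ γ, C γ * (step N * (γ : ℕ)) ^ 2) +
      1 / 12 * (∑ γ, C γ * (step N * (γ : ℕ)) ^ 3) + p₁ * y + p₀ := by
  unfold u
  rw [Finset.mul_sum, Finset.mul_sum, Finset.mul_sum, Finset.mul_sum, ← Finset.sum_add_distrib,
    ← Finset.sum_sub_distrib, ← Finset.sum_add_distrib]
  congr 2
  refine Finset.sum_congr rfl fun γ _ => ?_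
  have h : 0 ≤ step N * ((γ : ℕ) : ℝ) := by
    unfold step
    positivity
  rw [abs_of_nonpos (by linarith)]
  ring

theorem u_of_ge {N : ℕ} (hN : N ≠ 0) (C : Fin (N + 1) → ℝ) (p₁ p₀ : ℝ) {y : ℝ} (hy : 1 ≤ y) :
    u N C p₁ p₀ y = 1 / 12 * y ^ 3 * (∑ γ, C γ) -
      1 / 4 * y ^ 2 * (∑ γ, C γ * (step N * (γ : ℕ))) +
      1 / 4 * y * (∑ γ, C γ * (step N * (γ : ℕ)) ^ 2) -
      1 / 12 * (∑ γ, C γ * (step N * (γ : ℕ)) ^ 3) + p₁ * y + p₀ := by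
  unfold u
  rw [Finset.mul_sum, Finset.mul_sum, Finset.mul_sum, Finset.mul_sum, ← Finset.sum_sub_distrib,
    ← Finset.sum_add_distrib, ← Finset.sum_sub_distrib]
  congr 2
  refine Finset.sum_congr rfl fun γ _ => ?_
  have h := (step_mul_mem_Icc hN (Nat.lt_succ_iff.1 γ.2)).2
  rw [abs_of_nonneg (by linarith)]
  ring

/-- The moments are not known beforehand, so the defect `gridValue - u` is first only known to be
cubic outside `[0,1]`. Its fourth difference vanishes everywhere, so the cubic `L` valid on the left
persists on the whole grid. On the right the defect is `-L`, hence `L = 0`; its two leading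
coefficients are the moment defects. -/
theorem coeff_moments_and_u_eq {N : ℕ} (hN : 2 ≤ N) (t : ℝ) :
    ∑ γ, coeff N t γ = g₀ t ∧ ∑ γ, coeff N t γ * (step N * (γ : ℕ)) = g₁ t ∧
      ∀ k : ℤ, u N (coeff N t) ((a₁neg N t + a₁pos N t) / 2) ((a₀neg t + a₀pos N t) / 2)
        (step N * k) = gridValue N t k := by
  have hN0 : N ≠ 0 := by omega
  have hh := step_mul_self hN0
  have hpos := step_pos hN0
  set h := step N with hdef
  set p₁ := (a₁neg N t + a₁pos N t) / 2 with hp₁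
  set p₀ := (a₀neg t + a₀pos N t) / 2 with hp₀
  set α : ℝ := -(g₀ t - ∑ γ, coeff N t γ) / 12 with hα
  set β : ℝ := (g₁ t - ∑ γ, coeff N t γ * (h * (γ : ℕ))) / 4 with hβ
  set μ : ℝ := a₁neg N t + 1 / 4 * (∑ γ, coeff N t γ * (h * (γ : ℕ)) ^ 2) - p₁ with hμ
  set ν : ℝ := a₀neg t - 1 / 12 * (∑ γ, coeff N t γ * (h * (γ : ℕ)) ^ 3) - p₀ with hν
  set L : ℝ → ℝ := fun y => α * y ^ 3 + β * y ^ 2 + μ * y + ν with hL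
  set v : ℤ → ℝ := fun k => gridValue N t k - u N (coeff N t) p₁ p₀ (h * k) with hv
  have hvd : ∀ k, fourthDiff v k = 0 := by
    intro k
    have e : fourthDiff v k = fourthDiff (gridValue N t) k -
        fourthDiff (fun k => u N (coeff N t) p₁ p₀ (h * k)) k := by
      simp only [fourthDiff, hv]
      ring
    rw [e, fourthDiff_gridValue hN, fourthDiff_u, sub_self]
  have hleft : ∀ k : ℤ, k ≤ 0 → v k = L (h * k) := by
    intro k hk
    have hk' : (k : ℝ) ≤ 0 := by exact_mod_cast hk
    simp only [hv]
    rw [gridValue_of_nonpos hk, u_of_le _ _ _ (mul_nonpos_of_nonneg_of_nonpos hpos.le hk'),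
      leftCubic]
    simp only [hL, hα, hβ, hμ, hν, ← hdef]
    ring
  have hright : ∀ k : ℤ, (N : ℤ) ≤ k → v k = -L (h * k) := by
    intro k hk
    have hk' : (N : ℝ) ≤ k := by exact_mod_cast hk
    simp only [hv]
    rw [gridValue_of_ge hN0 hk, u_of_ge hN0 _ _ _ (by
      rw [← hh]
      exact mul_le_mul_of_nonneg_left hk' hpos.le), rightCubic]
    -- Taking `p₁` and `p₀` to be the averages makes the two lower coefficients antisymmetric too.
    simp only [hL, hα, hβ, hμ, hν, hp₁, hp₀, ← hdef]
    ring
  have hvL : ∀ k : ℤ, v k = L (h * k) := by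
    intro k
    refine sub_eq_zero.1 (eq_zero_of_fourthDiff_eq_zero (w := fun k => v k - L (h * k)) ?_ ?_ k)
    · intro k
      have e : fourthDiff (fun k => v k - L (h * k)) k = fourthDiff v k := by
        simp only [fourthDiff, hL]
        push_cast
        ring
      rw [e, hvd]
    · intro k hk
      rw [hleft k hk, sub_self]
  have hzero : ∀ j : ℕ, L (1 + j * h) = 0 := by
    intro j
    have e1 := hvL (N + j)
    have e2 := hright (N + j) (by omega)
    have e3 : h * ((N + j : ℤ) : ℝ) = 1 + j * h := by
      push_cast
      linear_combination hh
    rw [e3] at e1 e2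
    linarith
  have z0 := hzero 0
  have z1 := hzero 1
  have z2 := hzero 2
  have z3 := hzero 3
  simp only [hL] at z0 z1 z2 z3
  push_cast at z0 z1 z2 z3
  -- Four equally spaced zeros suffice: the third difference of `L` is `6 α h^3`, then the second is
  -- `2 β h^2`, then the first is `μ h`.
  have hα0 : α = 0 := by
    have : α * h ^ 3 = 0 := by linear_combination (z3 - 3 * z2 + 3 * z1 - z0) / 6
    exact (mul_eq_zero.1 this).resolve_right (pow_ne_zero _ hpos.ne')
  rw [hα0] at z0 z1 z2 z3
  have hβ0 : β = 0 := by
    have : β * h ^ 2 = 0 := by linear_combination (z2 - 2 * z1 + z0) / 2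
    exact (mul_eq_zero.1 this).resolve_right (pow_ne_zero _ hpos.ne')
  rw [hβ0] at z0 z1 z2 z3
  have hμ0 : μ = 0 := by
    have : μ * h = 0 := by linear_combination z1 - z0
    exact (mul_eq_zero.1 this).resolve_right hpos.ne'
  have hν0 : ν = 0 := by
    rw [hμ0] at z0
    linarith
  refine ⟨by linarith, by linarith, fun k => ?_⟩
  have e := hvL k
  simp only [hL, hα0, hβ0, hμ0, hν0, hv] at e
  linarith

theorem solvesSystem_coeff {N : ℕ} (hN : 2 ≤ N) (t : ℝ) :
    SolvesSystem N t (coeff N t) ((a₁neg N t + a₁pos N t) / 2) ((a₀neg t + a₀pos N t) / 2) := by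
  obtain ⟨h₀, h₁, hu⟩ := coeff_moments_and_u_eq hN t
  refine ⟨fun β => ?_, h₀, h₁⟩
  have h := hu ((β : ℕ) : ℤ)
  rw [gridValue_natCast (Nat.lt_succ_iff.1 β.2)] at h
  exact_mod_cast h

end CauchyQuad

theorem theorem1 (N : ℕ) (hN : 2 ≤ N) (t : ℝ) (ht₀ : 0 < t) (ht₁ : t < 1)
    (ht : ∀ β : ℕ, β ≤ N → t ≠ CauchyQuad.step N * β) :
    -- the singular integral exists on the whole space
    (∀ φ g : ℝ → ℝ, CauchyQuad.MemSobolevWith φ g →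
      CauchyQuad.HasSingularIntegral φ t (CauchyQuad.singularIntegral φ t)) ∧
    -- the closed forms of the right-hand sides
    (∀ β : ℕ, β ≤ N → CauchyQuad.HasSingularIntegral
      (fun x => |x - CauchyQuad.step N * β| ^ 3) t
      (12 * CauchyQuad.f (CauchyQuad.step N * β) t)) ∧
    CauchyQuad.HasSingularIntegral (fun _ => 1) t (CauchyQuad.g₀ t) ∧
    CauchyQuad.HasSingularIntegral (fun x => x) t (CauchyQuad.g₁ t) ∧
    -- the constants are well defined
    CauchyQuad.Δ N ≠ 0 ∧
    -- the optimal coefficients are exactly the explicit ones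
    (∀ C : Fin (N + 1) → ℝ,
      CauchyQuad.IsSardOptimal N t C ↔ C = CauchyQuad.coeff N t) ∧
    -- the linear system has exactly one solution, with the explicit coefficients
    (∀ (C : Fin (N + 1) → ℝ) (p₁ p₀ : ℝ),
      CauchyQuad.SolvesSystem N t C p₁ p₀ ↔
        C = CauchyQuad.coeff N t ∧
        p₁ = (CauchyQuad.a₁neg N t + CauchyQuad.a₁pos N t) / 2 ∧
        p₀ = (CauchyQuad.a₀neg t + CauchyQuad.a₀pos N t) / 2) ∧
    -- the constants are the coefficients of the function `u` outside `[0,1]`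
    (∀ (C : Fin (N + 1) → ℝ) (p₁ p₀ : ℝ), CauchyQuad.SolvesSystem N t C p₁ p₀ →
      (∀ k : ℤ, k ≤ 0 → CauchyQuad.u N C p₁ p₀ (CauchyQuad.step N * k) =
        -(1 / 12) * (CauchyQuad.step N * k) ^ 3 * CauchyQuad.g₀ t
          + (1 / 4) * (CauchyQuad.step N * k) ^ 2 * CauchyQuad.g₁ t
          + CauchyQuad.a₁neg N t * (CauchyQuad.step N * k) + CauchyQuad.a₀neg t) ∧
      (∀ k : ℤ, (N : ℤ) ≤ k → CauchyQuad.u N C p₁ p₀ (CauchyQuad.step N * k) =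
        (1 / 12) * (CauchyQuad.step N * k) ^ 3 * CauchyQuad.g₀ t
          - (1 / 4) * (CauchyQuad.step N * k) ^ 2 * CauchyQuad.g₁ t
          + CauchyQuad.a₁pos N t * (CauchyQuad.step N * k) + CauchyQuad.a₀pos N t)) := by

  have hN0 : N ≠ 0 := by omega
  have hsol := CauchyQuad.solvesSystem_coeff hN t
  obtain ⟨-, -, hu⟩ := CauchyQuad.coeff_moments_and_u_eq hN t
  refine ⟨?_, ?_, CauchyQuad.hasSingularIntegral_one ht₀ ht₁,
    CauchyQuad.hasSingularIntegral_id ht₀ ht₁, CauchyQuad.Δ_ne_zero hN0,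
    hsol.isSardOptimal_iff hN0 ht₀ ht₁ ht, ?_, ?_⟩
  · intro φ g hφ
    obtain ⟨a, b, hab⟩ := hφ.exists_eqOn
    have h := (CauchyQuad.hasSingularIntegral_doublePrimitive ht₀ ht₁
      (CauchyQuad.integrableOn_of_memLp_two hφ.memLp) a b).congr ht₀ ht₁ hab.symm
    rwa [h.singularIntegral_eq]
  · intro β hβ
    have hmem := CauchyQuad.step_mul_mem_Icc hN0 hβ
    exact CauchyQuad.hasSingularIntegral_abs_cubed hmem.1 hmem.2 ht₀ ht₁ (ht β hβ)
  · intro C p₁ p₀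
    constructor
    · exact fun hC => hsol.unique hN0 ht₀ ht₁ ht hC
    · rintro ⟨rfl, rfl, rfl⟩
      exact hsol
  · intro C p₁ p₀ hC
    obtain ⟨rfl, rfl, rfl⟩ := hsol.unique hN0 ht₀ ht₁ ht hC
    refine ⟨fun k hk => ?_, fun k hk => ?_⟩
    · rw [hu, CauchyQuad.gridValue_of_nonpos hk, CauchyQuad.leftCubic]
    · rw [hu, CauchyQuad.gridValue_of_ge hN0 hk, CauchyQuad.rightCubic]
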